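/- **Notation.** Let $\alpha>0$, $m=[\alpha]$ its integer part and $\sigma=\alpha-m\in[0,1)$. For $\tau>0$ let $${}^{-}I^{\tau}f(x)=\frac1{\Gamma(\tau)}\int_{-\infty}^{x}\frac{f(y)}{(x-y)^{1-\tau}}\,dy,\qquad {}^{+}I^{\tau}f(x)=\frac1{\Gamma(\tau)}\int_{x}^{\infty}\frac{f(y)}{(y-x)^{1-\tau}}\,dy$$ be the left and right Liouville fractional integrals. For $\varphi\in C_0^\infty(\mathbb R)$ the classical left and right derivatives of order $\alpha$ are ${}^{\pm}D^{\alpha}\varphi=\frac{d^m}{dx^m}\big({}^{\pm}D^{\sigma}\varphi\big)$, where ${}^{-}D^{\sigma}\varphi=\frac{d}{dx}\,{}^{-}I^{1-\sigma}\varphi$ and ${}^{+}D^{\sigma}\varphi=-\frac{d}{dx}\,{}^{+}I^{1-\sigma}\varphi$ if $0<\sigma<1$, and ${}^{\pm}D^{0}\varphi=\varphi$. For $u\in L^p(\mathbb R)$, $1\le p\le\infty$ (real-valued), a function $w\in L^1_{loc}(\mathbb R)$ is the left (superscript $-$) or right (superscript $+$) weak fractional derivative of order $\alpha$ of $u$,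 written ${}^{-}\mathcal D^{\alpha}u$ or ${}^{+}\mathcal D^{\alpha}u$, if for all $\varphi\in C_0^\infty(\mathbb R)$, respectively, $$\int_{\mathbb R} w\,\varphi\,dx=(-1)^{[\alpha]}\int_{\mathbb R}u\;{}^{+}D^{\alpha}\varphi\,dx \qquad\text{or}\qquad \int_{\mathbb R} w\,\varphi\,dx=(-1)^{[\alpha]}\int_{\mathbb R}u\;{}^{-}D^{\alpha}\varphi\,dx .$$ **Proposition (integration by parts on $\mathbb R$).** Let $\alpha>0$, $1\le p_k\le\infty$ and $\frac1{p_k}+\frac1{q_k}=1$ for $k=1,2$. Suppose that $u\in L^{p_1}(\mathbb R)$, $v\in L^{p_2}(\mathbb R)$, that the weak derivatives ${}^{\pm}\mathcal D^{\alpha}u$ and ${}^{\mp}\mathcal D^{\alpha}v$ exist, and that ${}^{\pm}\mathcal D^{\alpha}u\in L^{q_2}(\mathbb R)$ and ${}^{\mp}\mathcal D^{\alpha}v\in L^{q_1}(\mathbb R)$. If $p_1=\infty$ or $p_2=\infty$, assume in addition that at least one of the following holds: $u\in L^1(\mathbb R)$; or $v\in L^1(\mathbb R)$; or $\alpha+\frac1{p_1}+\frac1{p_2}\ge1$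 and $(\alpha,p_1,p_2)\ne(1,\infty,\infty)$. Then both integrals below converge absolutely and $$\int_{\mathbb R}{}^{\pm}\mathcal D^{\alpha}u\;v\,dx=(-1)^{[\alpha]}\int_{\mathbb R}u\;{}^{\mp}\mathcal D^{\alpha}v\,dx .$$ This holds for both choices of the signs. -/

import Mathlib

open MeasureTheory Set
open scoped ENNReal ContDiff

noncomputable section

/-- The two directions of fractional calculus on the real line:
`left` is written with a superscript minus, `right` with a superscript plus. -/
inductive FracSide where
  | left : FracSide
  | right : FracSide

/-- The opposite direction. -/
def FracSide.opp : FracSide → FracSide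
  | .left => .right
  | .right => .left

/-- The left and right Liouville fractional integrals of order `σ > 0` on the real line. -/
def fracIntegral : FracSide → ℝ → (ℝ → ℝ) → ℝ → ℝ
  | .left, σ, f, x => 1 / Real.Gamma σ * ∫ y in Iio x, f y / (x - y) ^ (1 - σ)
  | .right, σ, f, x => 1 / Real.Gamma σ * ∫ y in Ioi x, f y / (y - x) ^ (1 - σ)

/-- The Liouville fractional derivatives of order `σ`, `0 < σ < 1`:
`d/dx I^(1-σ)` on the left and `- d/dx I^(1-σ)` on the right. -/
def fracDerivUnit : FracSide → ℝ → (ℝ → ℝ) → ℝ → ℝ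
  | .left, σ, f, x => deriv (fracIntegral .left (1 - σ) f) x
  | .right, σ, f, x => -deriv (fracIntegral .right (1 - σ) f) x

/-- The classical fractional derivative of order `α > 0`: with `m` the integer part of `α` and
`σ = α - m`, it is the `m`-th derivative of the Liouville derivative of order `σ`, and for integer
`α` it is the ordinary derivative of order `α`. Thus, for `m < α < n = m + 1`, it is
`(d/dx)^n I^(n-α)` on the left and `(-1)^(n-m) (d/dx)^n I^(n-α)` on the right. -/
def fracDeriv (s : FracSide) (α : ℝ) (f : ℝ → ℝ) : ℝ → ℝ :=
  if Int.fract α = 0 then iteratedDeriv ⌊α⌋₊ f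
  else iteratedDeriv ⌊α⌋₊ (fracDerivUnit s (Int.fract α) f)

/-- `w` is the weak fractional derivative of `u` of order `α` in direction `s`: it is locally
integrable, and tested against smooth compactly supported functions it satisfies the integration
by parts identity with the classical fractional derivative in the opposite direction. -/
def IsWeakFracDeriv (s : FracSide) (α : ℝ) (u w : ℝ → ℝ) : Prop :=
  LocallyIntegrable w volume ∧
    ∀ φ : ℝ → ℝ, ContDiff ℝ ∞ φ → HasCompactSupport φ →
      ∫ x, w x * φ x = (-1) ^ ⌊α⌋₊ * ∫ x, u x * fracDeriv s.opp α φ x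

end

open Filter Topology

noncomputable section

/-! Write `D` for the weak derivatives and put `E z = ∫ Du (x + z) v x dx - (-1)^⌊α⌋ ∫ u (x + z) Dv
x dx`. Hölder's inequality makes `E` bounded and continuous, and the claim is `E 0 = 0`. In fact `E`
vanishes identically.

If `u ∈ L^a` and `v ∈ L^b` with `1/a + 1/b ≥ 1`, then for a test function `φ` the double integral of
`u y * v x * (D^α φ) (y - x)` converges absolutely. Both terms of `∫ φ E` reduce to it by Fubini and
cancel (`integral_testFunction_mul_correlation`).

Otherwise `1/p₁ + 1/p₂ < 1`, so `1/q₁ + 1/q₂ > 1`, and the double integral of `Du y * Dv x * φ (y -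
x)` converges instead. Hence `E` annihilates `D^α φ` (`integral_fracDeriv_mul_correlation`). A
Liouville theorem then gives `E = 0`, once polynomials, in particular constants, are excluded. This
exclusion is the role of null averages over long intervals. For finite exponents they follow by
approximating with integrable correlations. For an infinite exponent the derivative paired with the
bounded function is integrable, and the endpoint condition forces it to have mean zero
(`IsWeakFracDeriv.integral_eq_zero`), which suffices.

The Liouville theorem rests on the Marchaud formula: at near-maximum points, a vanishing integral of
weighted differences keeps the function near its supremum on a long interval, against null averages
(`nonpos_of_marchaud_eq_zero`). -/

/-- The correlation `z ↦ ∫ w (x + z) v (x) dx` of two functions on the line. -/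
def correlation (w v : ℝ → ℝ) (z : ℝ) : ℝ := ∫ x, w (x + z) * v x

/-! ### Correlations of functions in conjugate Lebesgue spaces. -/

section Holder

variable {w v : ℝ → ℝ} {p q : ℝ≥0∞}

lemma integral_norm_mul_le_eLpNorm (hpq : ENNReal.HolderConjugate q p) (hw : MemLp w q volume)
    (hv : MemLp v p volume) :
    ∫ x, ‖w x * v x‖ ≤ (eLpNorm w q volume).toReal * (eLpNorm v p volume).toReal := by
  have h := eLpNorm_smul_le_mul_eLpNorm (r := 1) hv.1 hw.1 (hpqr := hpq)
  rw [integral_norm_eq_lintegral_enorm (f := fun x => w x * v x) (hw.1.mul hv.1),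
    ← ENNReal.toReal_mul]
  refine ENNReal.toReal_mono (ENNReal.mul_ne_top hw.2.ne hv.2.ne) ?_
  rw [eLpNorm_one_eq_lintegral_enorm] at h
  exact h

lemma abs_integral_mul_le_eLpNorm (hpq : ENNReal.HolderConjugate q p) (hw : MemLp w q volume)
    (hv : MemLp v p volume) :
    |∫ x, w x * v x| ≤ (eLpNorm w q volume).toReal * (eLpNorm v p volume).toReal :=
  (norm_integral_le_integral_norm _).trans (integral_norm_mul_le_eLpNorm hpq hw hv)

lemma memLp_comp_add_right (hw : MemLp w q volume) (z : ℝ) :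
    MemLp (fun x => w (x + z)) q volume :=
  hw.comp_measurePreserving (measurePreserving_add_right volume z)

lemma eLpNorm_comp_add_right (hw : MemLp w q volume) (z : ℝ) :
    eLpNorm (fun x => w (x + z)) q volume = eLpNorm w q volume :=
  eLpNorm_comp_measurePreserving hw.1 (measurePreserving_add_right volume z)

lemma integrable_mul_of_holderConjugate (hpq : ENNReal.HolderConjugate q p)
    (hw : MemLp w q volume) (hv : MemLp v p volume) : Integrable (fun x => w x * v x) volume :=
  haveI := hpq
  hw.integrable_mul hv

lemma integrable_shift_mul (hpq : ENNReal.HolderConjugate q p)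
    (hw : MemLp w q volume) (hv : MemLp v p volume) (z : ℝ) :
    Integrable (fun x => w (x + z) * v x) volume :=
  integrable_mul_of_holderConjugate hpq (memLp_comp_add_right hw z) hv

lemma abs_correlation_le (hpq : ENNReal.HolderConjugate q p) (hw : MemLp w q volume)
    (hv : MemLp v p volume) (z : ℝ) :
    |correlation w v z| ≤ (eLpNorm w q volume).toReal * (eLpNorm v p volume).toReal := by
  rw [← eLpNorm_comp_add_right hw z]
  exact abs_integral_mul_le_eLpNorm hpq (memLp_comp_add_right hw z) hv

lemma correlation_swap (w v : ℝ → ℝ) (z : ℝ) : correlation w v z = correlation v w (-z) := by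
  unfold correlation
  rw [← integral_add_right_eq_self (fun x => v (x + -z) * w x) z]
  simp [mul_comm]

lemma correlation_sub_left (hpq : ENNReal.HolderConjugate q p) {g : ℝ → ℝ}
    (hw : MemLp w q volume) (hg : MemLp g q volume) (hv : MemLp v p volume) (z : ℝ) :
    correlation w v z - correlation g v z = correlation (w - g) v z := by
  unfold correlation
  rw [← integral_sub (integrable_shift_mul hpq hw hv z) (integrable_shift_mul hpq hg hv z)]
  simp [sub_mul]

/-- In the first argument, correlations of conjugate exponents are uniform limits of correlations
with continuous compactly supported functions. -/
lemma exists_correlation_approx (hpq : ENNReal.HolderConjugate q p) (hq : q ≠ ⊤)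
    (hw : MemLp w q volume) (hv : MemLp v p volume) {ε : ℝ} (hε : 0 < ε) :
    ∃ g : ℝ → ℝ, HasCompactSupport g ∧ Continuous g ∧
      ∀ z, |correlation w v z - correlation g v z| ≤ ε := by
  set C := (eLpNorm v p volume).toReal with hC
  have hC0 : 0 ≤ C := ENNReal.toReal_nonneg
  obtain ⟨g, h1, h2, h3, h4⟩ := hw.exists_hasCompactSupport_eLpNorm_sub_le hq
    (ε := ENNReal.ofReal (ε / (C + 1))) (by simpa using by positivity)
  refine ⟨g, h1, h3, fun z => ?_⟩
  rw [correlation_sub_left hpq hw h4 hv]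
  refine (abs_correlation_le hpq (hw.sub h4) hv z).trans ?_
  have h5 : (eLpNorm (w - g) q volume).toReal ≤ ε / (C + 1) :=
    ENNReal.toReal_le_of_le_ofReal (by positivity) h2
  calc _ ≤ ε / (C + 1) * C := by gcongr
    _ ≤ ε := by rw [div_mul_eq_mul_div, div_le_iff₀ (by positivity)]; nlinarith

open scoped Convolution in
-- Gives access to the continuity and differentiation theorems for convolutions.
lemma correlation_eq_convolution (g v : ℝ → ℝ) :
    correlation g v = (fun x => v (-x)) ⋆[ContinuousLinearMap.mul ℝ ℝ, volume] g := by
  ext z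
  unfold correlation convolution
  rw [← integral_neg_eq_self]
  simp only [ContinuousLinearMap.mul_apply']
  congr 1; ext x; rw [mul_comm]; congr 2; ring

lemma locallyIntegrable_comp_neg (hp1 : 1 ≤ p) (hv : MemLp v p volume) :
    LocallyIntegrable (fun x => v (-x)) volume :=
  (hv.comp_measurePreserving (Measure.measurePreserving_neg volume)).locallyIntegrable hp1

lemma continuous_correlation_of_hasCompactSupport {g : ℝ → ℝ} (hg : HasCompactSupport g)
    (hgc : Continuous g) (hp1 : 1 ≤ p) (hv : MemLp v p volume) : Continuous (correlation g v) := by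
  rw [correlation_eq_convolution]
  exact hg.continuous_convolution_right _ (locallyIntegrable_comp_neg hp1 hv) hgc

/-- At least one of two conjugate exponents is finite. Reflection puts it in the first slot, where
approximation by continuous compactly supported functions is uniform in the shift. -/
lemma continuous_correlation (hpq : ENNReal.HolderConjugate q p)
    (hw : MemLp w q volume) (hv : MemLp v p volume) : Continuous (correlation w v) := by
  wlog hq : q ≠ ⊤ generalizing w v p q
  · have hp : p ≠ ⊤ := by
      rintro rfl
      push Not at hq
      subst hq
      have := @ENNReal.HolderConjugate.inv_add_inv_eq_one ⊤ ⊤ hpq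
      simp at this
    have : Continuous (fun z => correlation v w (-z)) := (this hpq.symm hv hw hp).comp continuous_neg
    simpa only [← correlation_swap] using this
  · have hp1 : 1 ≤ p := hpq.symm.one_le
    refine continuous_of_uniform_approx_of_continuous fun u hu => ?_
    obtain ⟨ε, hε, hεu⟩ := Metric.mem_uniformity_dist.1 hu
    obtain ⟨g, h1, h2, h3⟩ := exists_correlation_approx hpq hq hw hv (half_pos hε)
    refine ⟨correlation g v, continuous_correlation_of_hasCompactSupport h1 h2
 hp1 hv, fun z => hεu ?_⟩
    rw [Real.dist_eq]
    linarith [h3 z]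

end Holder

/-! ### Absolute convergence of the trilinear form with a convolution kernel. -/

section Trilinear

variable {w v K : ℝ → ℝ}

lemma aestronglyMeasurable_trilinear (hw : AEStronglyMeasurable w volume)
    (hv : AEStronglyMeasurable v volume) (hK : AEStronglyMeasurable K volume) :
    AEStronglyMeasurable (fun P : ℝ × ℝ => w P.1 * v P.2 * K (P.1 - P.2))
      (volume.prod volume) :=
  (hw.comp_fst.mul hv.comp_snd).mul
    (hK.comp_quasiMeasurePreserving (quasiMeasurePreserving_sub volume volume))

/-- Hölder's inequality on the lines `y - x = z`. -/
lemma integrable_trilinear_of_holderConjugate {p q : ℝ≥0∞} (hpq : ENNReal.HolderConjugate q p)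
    (hw : MemLp w q volume) (hv : MemLp v p volume) (hK : Integrable K volume) :
    Integrable (fun P : ℝ × ℝ => w P.1 * v P.2 * K (P.1 - P.2)) (volume.prod volume) := by
  -- The shear `(z, x) ↦ (z + x, x)` preserves the measure and makes the kernel depend on `z` alone.
  have hmp := measurePreserving_add_prod (volume : Measure ℝ) (volume : Measure ℝ)
  have hmeas := aestronglyMeasurable_trilinear hw.1 hv.1 hK.1
  have hfun : (fun P : ℝ × ℝ => w P.1 * v P.2 * K (P.1 - P.2)) ∘
      (fun P : ℝ × ℝ => (P.1 + P.2, P.2)) =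
      fun P : ℝ × ℝ => w (P.2 + P.1) * v P.2 * K P.1 := by
    ext P; simp [add_comm]
  rw [← hmp.integrable_comp hmeas, hfun]
  have hmeas' := hmeas.comp_measurePreserving hmp
  rw [hfun] at hmeas'
  rw [integrable_prod_iff hmeas']
  refine ⟨Eventually.of_forall fun z =>
    (integrable_shift_mul hpq hw hv z).mul_const (K z), ?_⟩
  refine (hK.norm.const_mul ((eLpNorm w q volume).toReal * (eLpNorm v p volume).toReal)).mono'
    hmeas'.norm.integral_prod_right' (Eventually.of_forall fun z => ?_)
  have h0 : (fun x => ‖w (x + z) * v x * K z‖) = fun x => ‖w (x + z) * v x‖ * ‖K z‖ := by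
    ext x; rw [norm_mul]
  simp only [h0, integral_mul_const]
  rw [Real.norm_of_nonneg (mul_nonneg (integral_nonneg fun _ => norm_nonneg _) (norm_nonneg _))]
  gcongr
  rw [← eLpNorm_comp_add_right hw z]
  exact integral_norm_mul_le_eLpNorm hpq (memLp_comp_add_right hw z) hv

lemma integrable_trilinear_of_bounded (hw : Integrable w volume) (hv : Integrable v volume)
    (hK : MemLp K ⊤ volume) :
    Integrable (fun P : ℝ × ℝ => w P.1 * v P.2 * K (P.1 - P.2)) (volume.prod volume) := by
  have hKm : AEStronglyMeasurable (fun P : ℝ × ℝ => K (P.1 - P.2)) (volume.prod volume) :=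
    hK.1.comp_quasiMeasurePreserving (quasiMeasurePreserving_sub volume volume)
  refine (hw.mul_prod hv).mul_bdd (c := (eLpNorm K ⊤ volume).toReal) hKm ?_
  have h : ∀ᵐ x ∂(volume : Measure ℝ), ‖K x‖ ≤ (eLpNorm K ⊤ volume).toReal := by
    filter_upwards [ae_le_eLpNormEssSup (f := K) (μ := volume)] with x hx
    rw [eLpNorm_exponent_top, ← toReal_enorm]
    exact ENNReal.toReal_mono (by simpa using hK.2.ne) hx
  exact (quasiMeasurePreserving_sub (volume : Measure ℝ) volume).ae h

lemma integral_correlation_mul (h : Integrable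
    (fun P : ℝ × ℝ => w P.1 * v P.2 * K (P.1 - P.2)) (volume.prod volume)) :
    ∫ z, K z * correlation w v z = ∫ y, w y * ∫ x, v x * K (y - x) := by
  have hmp := measurePreserving_add_prod (volume : Measure ℝ) (volume : Measure ℝ)
  have h1 := (hmp.integrable_comp h.1).2 h
  have h2 := integral_map hmp.aemeasurable (by rw [hmp.map_eq]; exact h.1)
  rw [hmp.map_eq, integral_prod _ h, integral_prod _ (by simpa [Function.comp_def] using h1)] at h2
  simp only [mul_assoc, integral_const_mul] at h2
  rw [h2]
  congr 1; ext z
  unfold correlation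
  rw [← integral_const_mul]
  congr 1; ext x
  rw [add_sub_cancel_right, add_comm z x]
  ring

lemma integral_trilinear_swap (h : Integrable
    (fun P : ℝ × ℝ => w P.1 * v P.2 * K (P.1 - P.2)) (volume.prod volume)) :
    ∫ y, w y * ∫ x, v x * K (y - x) = ∫ x, v x * ∫ y, w y * K (y - x) := by
  have h1 := integral_integral_swap (f := fun y x => w y * v x * K (y - x)) h
  have e1 : ∀ y, ∫ x, w y * v x * K (y - x) = w y * ∫ x, v x * K (y - x) := fun y => by
    rw [← integral_const_mul]; simp only [mul_assoc]
  have e2 : ∀ x, ∫ y, w y * v x * K (y - x) = v x * ∫ y, w y * K (y - x) := fun x => by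
    rw [← integral_const_mul]; congr 1; ext y; ring
  simpa only [e1, e2] using h1

/-- The part of `f` where it is at most one in absolute value. -/
def smallPart (f : ℝ → ℝ) (x : ℝ) : ℝ := if |f x| ≤ 1 then f x else 0

/-- The part of `f` where it exceeds one in absolute value. -/
def bigPart (f : ℝ → ℝ) (x : ℝ) : ℝ := if |f x| ≤ 1 then 0 else f x

lemma smallPart_add_bigPart (f : ℝ → ℝ) (x : ℝ) : smallPart f x + bigPart f x = f x := by
  unfold smallPart bigPart; split_ifs <;> simp

lemma memLp_of_abs_rpow_le {f g : ℝ → ℝ} {a b : ℝ≥0∞} (ha : MemLp f a volume) (ha0 : a ≠ 0)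
    (ha' : a ≠ ⊤) (hb0 : b ≠ 0) (hb' : b ≠ ⊤) (hg : AEStronglyMeasurable g volume)
    (h : ∀ x, |g x| ^ b.toReal ≤ |f x| ^ a.toReal) : MemLp g b volume := by
  have h1 := (integrable_norm_rpow_iff ha.1 ha0 ha').2 ha
  refine (integrable_norm_rpow_iff hg hb0 hb').1 (h1.mono'
    (hg.norm.aemeasurable.pow_const _).aestronglyMeasurable (Eventually.of_forall fun x => ?_))
  rw [Real.norm_of_nonneg (by positivity)]
  exact h x

lemma aestronglyMeasurable_smallPart {f : ℝ → ℝ} (hf : AEStronglyMeasurable f volume) :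
    AEStronglyMeasurable (smallPart f) volume := by
  have h : Measurable (fun t : ℝ => if |t| ≤ 1 then t else 0) :=
    Measurable.ite (measurableSet_le (by fun_prop) measurable_const) measurable_id measurable_const
  exact (h.comp_aemeasurable hf.aemeasurable).aestronglyMeasurable

lemma aestronglyMeasurable_bigPart {f : ℝ → ℝ} (hf : AEStronglyMeasurable f volume) :
    AEStronglyMeasurable (bigPart f) volume := by
  have h : Measurable (fun t : ℝ => if |t| ≤ 1 then 0 else t) :=
    Measurable.ite (measurableSet_le (by fun_prop) measurable_const) measurable_const measurable_id
  exact (h.comp_aemeasurable hf.aemeasurable).aestronglyMeasurable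

lemma memLp_smallPart {f : ℝ → ℝ} {a b : ℝ≥0∞} (ha : MemLp f a volume) (ha1 : 1 ≤ a)
    (hab : a ≤ b) : MemLp (smallPart f) b volume := by
  have hm := aestronglyMeasurable_smallPart ha.1
  have hle : ∀ x, |smallPart f x| ≤ 1 := fun x => by
    unfold smallPart; split_ifs with h <;> simp [h]
  by_cases hb : b = ⊤
  · subst hb
    exact memLp_top_of_bound hm 1 (Eventually.of_forall hle)
  have ha' : a ≠ ⊤ := ne_top_of_le_ne_top hb hab
  have ha0 : a ≠ 0 := (one_pos.trans_le ha1).ne'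
  have hb0 : b ≠ 0 := (one_pos.trans_le (ha1.trans hab)).ne'
  refine memLp_of_abs_rpow_le ha ha0 ha' hb0 hb hm fun x => ?_
  have hab' : a.toReal ≤ b.toReal := ENNReal.toReal_mono hb hab
  have hap : 0 < a.toReal := ENNReal.toReal_pos ha0 ha'
  unfold smallPart
  split_ifs with h
  · rcases eq_or_ne (f x) 0 with h0 | h0
    · rw [h0, abs_zero, Real.zero_rpow hap.ne', Real.zero_rpow (hap.trans_le hab').ne']
    · exact Real.rpow_le_rpow_of_exponent_ge (abs_pos.2 h0) h hab'
  · rw [abs_zero, Real.zero_rpow (hap.trans_le hab').ne']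
    positivity

lemma integrable_bigPart {f : ℝ → ℝ} {a : ℝ≥0∞} (ha : MemLp f a volume) (ha1 : 1 ≤ a)
    (ha' : a ≠ ⊤) : Integrable (bigPart f) volume := by
  have hm := aestronglyMeasurable_bigPart ha.1
  have ha0 : a ≠ 0 := (one_pos.trans_le ha1).ne'
  have hap : 1 ≤ a.toReal := by simpa using ENNReal.toReal_mono ha' ha1
  refine memLp_one_iff_integrable.1
    (memLp_of_abs_rpow_le ha ha0 ha' one_ne_zero ENNReal.one_ne_top hm fun x => ?_)
  unfold bigPart
  rw [ENNReal.toReal_one, Real.rpow_one]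
  split_ifs with h
  · rw [abs_zero]; positivity
  · exact Real.self_le_rpow_of_one_le (not_le.1 h).le hap

lemma le_of_one_le_inv_add_inv {a b b' : ℝ≥0∞} (hb : ENNReal.HolderConjugate b b')
    (hab : 1 ≤ a⁻¹ + b⁻¹) : a ≤ b' := by
  have h := @ENNReal.HolderConjugate.inv_add_inv_eq_one b b' hb
  rw [← ENNReal.inv_le_inv]
  have hb0 : b⁻¹ ≠ ⊤ := by
    intro h0; rw [h0] at h; simp at h
  rw [← h, add_comm] at hab
  exact (ENNReal.add_le_add_iff_right hb0).1 hab

/-- Truncation replaces interpolation. Since `1/a + 1/b ≥ 1` means `a ≤ b'` and `b ≤ a'`, the small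
part of `w` lies in `L^{b'}` and that of `v` in `L^{a'}`, so Hölder applies to every product
containing a small part. The two big parts are integrable, and there the boundedness of `K` is
enough. -/
lemma integrable_trilinear_aux {a b : ℝ≥0∞} (ha1 : 1 ≤ a) (hb1 : 1 ≤ b)
    (hab : 1 ≤ a⁻¹ + b⁻¹) (ha' : a ≠ ⊤) (hb' : b ≠ ⊤)
    (hw : MemLp w a volume) (hv : MemLp v b volume) (hK : Integrable K volume)
    (hK' : MemLp K ⊤ volume) :
    Integrable (fun P : ℝ × ℝ => w P.1 * v P.2 * K (P.1 - P.2)) (volume.prod volume) := by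
  have hca := ENNReal.HolderConjugate.conjExponent ha1
  have hcb := ENNReal.HolderConjugate.conjExponent hb1
  have h1 := integrable_trilinear_of_holderConjugate hcb.symm
    (memLp_smallPart hw ha1 (le_of_one_le_inv_add_inv hcb hab)) hv hK
  have h2 := integrable_trilinear_of_holderConjugate hca hw
    (memLp_smallPart hv hb1 (le_of_one_le_inv_add_inv hca (by rwa [add_comm]))) hK
  have hca' := integrable_bigPart hw ha1 ha'
  have h2' : Integrable (fun P : ℝ × ℝ => bigPart w P.1 * smallPart v P.2 * K (P.1 - P.2))
      (volume.prod volume) := by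
    refine h2.mono (aestronglyMeasurable_trilinear (aestronglyMeasurable_bigPart hw.1)
      (aestronglyMeasurable_smallPart hv.1) hK.1) (Eventually.of_forall fun P => ?_)
    simp only [norm_mul]
    gcongr
    unfold bigPart; split_ifs <;> simp
  have h3 := integrable_trilinear_of_bounded hca' (integrable_bigPart hv hb1 hb') hK'
  refine ((h1.add h2').add h3).congr (Eventually.of_forall fun P => ?_)
  simp only [Pi.add_apply]
  have e1 := smallPart_add_bigPart w P.1
  have e2 := smallPart_add_bigPart v P.2
  linear_combination v P.2 * K (P.1 - P.2) * e1 + bigPart w P.1 * K (P.1 - P.2) * e2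
/-- The case of Young's inequality for a kernel in every Lebesgue space. -/
lemma integrable_trilinear {a b : ℝ≥0∞} (ha1 : 1 ≤ a) (hb1 : 1 ≤ b) (hab : 1 ≤ a⁻¹ + b⁻¹)
    (hw : MemLp w a volume) (hv : MemLp v b volume) (hK : Integrable K volume)
    (hK' : MemLp K ⊤ volume) :
    Integrable (fun P : ℝ × ℝ => w P.1 * v P.2 * K (P.1 - P.2)) (volume.prod volume) := by
  by_cases ha' : a = ⊤
  · subst ha'
    have hb : b = 1 := le_antisymm (by simpa using hab) hb1
    subst hb
    exact integrable_trilinear_of_holderConjugate inferInstance hw hv hK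
  by_cases hb' : b = ⊤
  · subst hb'
    have ha : a = 1 := le_antisymm (by simpa using hab) ha1
    subst ha
    exact integrable_trilinear_of_holderConjugate inferInstance hw hv hK
  exact integrable_trilinear_aux ha1 hb1 hab ha' hb' hw hv hK hK'

end Trilinear

end

/-! ### Functions with uniformly vanishing averages. -/

/-- The averages of `f` over intervals of length `R` tend to zero uniformly as `R → ∞`. -/
def HasNullAverages (f : ℝ → ℝ) : Prop :=
  ∀ ε > 0, ∀ᶠ R : ℝ in atTop, ∀ x, |∫ t in (0 : ℝ)..R, f (x + t)| ≤ ε * R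

lemma intervalIntegrable_comp_add_left {f : ℝ → ℝ} (hf : Continuous f) (x a b : ℝ) :
    IntervalIntegrable (fun t => f (x + t)) volume a b :=
  (show Continuous fun t => f (x + t) by fun_prop).intervalIntegrable a b

namespace HasNullAverages

variable {f g : ℝ → ℝ}

lemma comp_neg (hf : HasNullAverages f) : HasNullAverages (fun x => f (-x)) := by
  intro ε hε
  filter_upwards [hf ε hε] with R hR x
  -- Reflection carries `[x, x + R]` to the interval of the same length starting at `-x - R`.
  have h := intervalIntegral.integral_comp_sub_left (a := 0) (b := R)
    (fun t => f (-x - R + t)) R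
  simp only [sub_self, sub_zero] at h
  have h2 : ∫ t in (0 : ℝ)..R, f (-(x + t)) = ∫ t in (0 : ℝ)..R, f (-x - R + (R - t)) := by
    congr 1; ext t; congr 1; ring
  rw [h2, h]
  exact hR _

lemma sub_const_mul (hf : HasNullAverages f) (hg : HasNullAverages g) (hfc : Continuous f)
    (hgc : Continuous g) (c : ℝ) : HasNullAverages (fun x => f x - c * g x) := by
  intro ε hε
  filter_upwards [hf (ε / 2) (half_pos hε), hg (ε / (2 * (|c| + 1))) (by positivity),
    eventually_ge_atTop 0] with R h1 h2 hR x
  rw [intervalIntegral.integral_sub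
    (intervalIntegrable_comp_add_left hfc _ _ _)
    ((intervalIntegrable_comp_add_left hgc _ _ _).const_mul _),
    intervalIntegral.integral_const_mul]
  refine (abs_sub _ _).trans ?_
  rw [abs_mul]
  have h3 : |c| * |∫ t in (0 : ℝ)..R, g (x + t)| ≤ (|c| + 1) * (ε / (2 * (|c| + 1)) * R) :=
    mul_le_mul (by linarith) (h2 x) (abs_nonneg _) (by positivity)
  have h4 : (|c| + 1) * (ε / (2 * (|c| + 1)) * R) = ε / 2 * R := by
    have : |c| + 1 ≠ 0 := by positivity
    field_simp
  have := h1 x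
  linarith

lemma of_uniform_approx (hfc : Continuous f)
    (h : ∀ ε > 0, ∃ g, Continuous g ∧ HasNullAverages g ∧ ∀ x, |f x - g x| ≤ ε) :
    HasNullAverages f := by
  intro ε hε
  obtain ⟨g, hgc, hg, hfg⟩ := h (ε / 2) (half_pos hε)
  filter_upwards [hg (ε / 2) (half_pos hε), eventually_ge_atTop 0] with R h1 hR x
  have h2 : |∫ t in (0 : ℝ)..R, (f (x + t) - g (x + t))| ≤ ε / 2 * R := by
    have := intervalIntegral.norm_integral_le_of_norm_le_const (a := 0) (b := R)
      (f := fun t => f (x + t) - g (x + t)) (C := ε / 2) (fun t _ => hfg _)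
    simpa [abs_of_nonneg hR] using this
  rw [intervalIntegral.integral_sub
    (intervalIntegrable_comp_add_left hfc _ _ _)
    (intervalIntegrable_comp_add_left hgc _ _ _)] at h2
  have h3 := abs_sub_abs_le_abs_sub (∫ t in (0 : ℝ)..R, f (x + t)) (∫ t in (0 : ℝ)..R, g (x + t))
  linarith [h1 x]

lemma of_integrable (hf : Integrable f volume) : HasNullAverages f := by
  intro ε hε
  filter_upwards [eventually_ge_atTop 0, eventually_ge_atTop ((∫ x, ‖f x‖) / ε)] with R hR hR2 x
  rw [div_le_iff₀ hε] at hR2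
  rw [mul_comm]
  refine le_trans ?_ hR2
  rw [intervalIntegral.integral_of_le hR]
  refine (norm_integral_le_integral_norm (fun t => f (x + t))).trans ?_
  rw [← integral_add_left_eq_self (fun y => ‖f y‖) x]
  exact setIntegral_le_integral (hf.norm.comp_add_left x)
    (Eventually.of_forall fun _ => norm_nonneg _)

lemma eq_zero_of_const {c : ℝ} (h : HasNullAverages fun _ => c) : c = 0 := by
  refine abs_nonpos_iff.1 (le_of_forall_pos_le_add fun ε hε => ?_)
  obtain ⟨R, hR, hR0⟩ := ((h ε hε).and (eventually_gt_atTop 0)).exists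
  have := hR 0
  simp only [intervalIntegral.integral_const, sub_zero, smul_eq_mul, abs_mul, abs_of_pos hR0] at this
  rw [zero_add]
  exact le_of_mul_le_mul_left (by linarith) hR0

end HasNullAverages

/-! ### Null averages of correlations. -/

section Correlation

variable {w v : ℝ → ℝ} {p q : ℝ≥0∞}

lemma integrable_correlation (hw : Integrable w volume) (hv : Integrable v volume) :
    Integrable (correlation w v) volume := by
  have hmp := measurePreserving_add_prod (volume : Measure ℝ) (volume : Measure ℝ)
  have h := ((hmp.integrable_comp (hw.mul_prod hv).1).2 (hw.mul_prod hv)).integral_prod_left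
  refine h.congr (Eventually.of_forall fun z => ?_)
  simp only [Function.comp_apply, correlation]
  simp_rw [add_comm z]

/-- Each argument in turn is replaced by a continuous compactly supported function, with a
reflection in between. The resulting correlation is integrable, and null averages survive uniform
limits. -/
lemma hasNullAverages_correlation (hpq : ENNReal.HolderConjugate q p) (hq : q ≠ ⊤) (hp : p ≠ ⊤)
    (hw : MemLp w q volume) (hv : MemLp v p volume) : HasNullAverages (correlation w v) := by
  refine .of_uniform_approx (continuous_correlation hpq hw hv) fun ε hε => ?_
  obtain ⟨g, hg1, hg2, hg3⟩ := exists_correlation_approx hpq hq hw hv hε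
  have hgq : MemLp g q volume := hg2.memLp_of_hasCompactSupport hg1
  refine ⟨correlation g v, continuous_correlation hpq hgq hv, ?_, hg3⟩
  suffices h : HasNullAverages (correlation v g) by
    simpa only [← correlation_swap] using h.comp_neg
  refine .of_uniform_approx (continuous_correlation hpq.symm hv hgq) fun ε hε => ?_
  obtain ⟨h, hh1, hh2, hh3⟩ := exists_correlation_approx hpq.symm hp hv hgq hε
  exact ⟨correlation h g,
    continuous_correlation hpq.symm (hh2.memLp_of_hasCompactSupport hh1) hgq,
    .of_integrable (integrable_correlation (hh2.integrable_of_hasCompactSupport hh1)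
      (hg2.integrable_of_hasCompactSupport hg1)), hh3⟩

lemma ae_abs_le_of_memLp_top (hv : MemLp v ⊤ volume) :
    ∃ C, 0 ≤ C ∧ ∀ᵐ x ∂(volume : Measure ℝ), |v x| ≤ C := by
  refine ⟨(eLpNorm v ⊤ volume).toReal, ENNReal.toReal_nonneg, ?_⟩
  filter_upwards [ae_le_eLpNormEssSup (f := v) (μ := volume)] with x hx
  rw [eLpNorm_exponent_top, ← Real.norm_eq_abs, ← toReal_enorm]
  exact ENNReal.toReal_mono (by simpa using hv.2.ne) hx

lemma abs_intervalIntegral_le_of_ae {C : ℝ} (hC : ∀ᵐ x ∂(volume : Measure ℝ), |v x| ≤ C)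
    (a b : ℝ) : |∫ x in a..b, v x| ≤ C * |b - a| := by
  rw [← Real.norm_eq_abs]
  exact intervalIntegral.norm_integral_le_of_norm_le_const_ae (hC.mono fun x hx _ => hx)

/-- Integrals of correlations over intervals. -/
lemma integral_correlation_interval (hw : Integrable w volume) (hv : MemLp v ⊤ volume)
    {R : ℝ} (hR : 0 ≤ R) (x : ℝ) :
    ∫ t in (0 : ℝ)..R, correlation w v (x + t) =
      ∫ y, w y * ∫ s in (y - (x + R))..(y - x), v s := by
  have hK : Integrable (indicator (Ico x (x + R)) (fun _ => (1 : ℝ))) volume :=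
    (integrable_indicator_iff measurableSet_Ico).2 (by simp [IntegrableOn])
  have h := integral_correlation_mul (integrable_trilinear_of_holderConjugate inferInstance
    (memLp_one_iff_integrable.2 hw) hv hK)
  have h1 : ∫ t in (0 : ℝ)..R, correlation w v (x + t) =
      ∫ z, indicator (Ico x (x + R)) (fun _ => (1 : ℝ)) z * correlation w v z := by
    rw [intervalIntegral.integral_comp_add_left, add_zero, intervalIntegral.integral_of_le
      (by linarith), ← integral_Ico_eq_integral_Ioc, ← integral_indicator measurableSet_Ico]
    congr 1; ext z; simp [indicator]
  rw [h1, h]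
  congr 1; ext y; congr 1
  rw [intervalIntegral.integral_of_le (by linarith), ← integral_indicator measurableSet_Ioc]
  congr 1; ext s
  by_cases hs : s ∈ Ioc (y - (x + R)) (y - x)
  · rw [indicator_of_mem hs, indicator_of_mem, mul_one]
    exact ⟨by linarith [hs.2], by linarith [hs.1]⟩
  · rw [indicator_of_notMem hs, indicator_of_notMem, mul_zero]
    exact fun h' => hs ⟨by linarith [h'.2], by linarith [h'.1]⟩

/-- The integral over an interval of length `R` pairs `w` with a window integral `V` of `v`. Mean
zero allows `V 0` to be subtracted, and `V` is Lipschitz with a constant independent of `R` and of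
the position of the interval. -/
lemma hasNullAverages_correlation_of_integral_eq_zero (hw : Integrable w volume)
    (hw0 : ∫ x, w x = 0) (hv : MemLp v ⊤ volume) : HasNullAverages (correlation w v) := by
  obtain ⟨C, hC0, hC⟩ := ae_abs_le_of_memLp_top hv
  have hvi : ∀ a b, IntervalIntegrable v volume a b := fun a b =>
    ((hv.locallyIntegrable le_top).integrableOn_isCompact isCompact_uIcc).intervalIntegrable
  -- The minimum bounds `|V y - V 0| / R`: the first entry comes from `|V| ≤ C * R`, the second from
  -- the Lipschitz bound. It does not involve `x`, hence the uniformity.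
  have hlim : Tendsto (fun R : ℝ => ∫ y, |w y| * min (2 * C) (2 * C * |y| * R⁻¹)) atTop (𝓝 0) := by
    have : (0 : ℝ) = ∫ y, |w y| * min (2 * C) (2 * C * |y| * 0) := by
      simp [hC0]
    rw [this]
    refine tendsto_integral_filter_of_dominated_convergence (fun y => |w y| * (2 * C)) ?_ ?_
      (hw.abs.mul_const _) (Eventually.of_forall fun y => ?_)
    · exact Eventually.of_forall fun R => hw.abs.1.mul (by fun_prop)
    · filter_upwards [eventually_gt_atTop 0] with R hR
      refine Eventually.of_forall fun y => ?_
      rw [Real.norm_of_nonneg (by positivity)]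
      gcongr
      exact min_le_left _ _
    · exact (tendsto_const_nhds.mul (tendsto_const_nhds.min
        (tendsto_const_nhds.mul tendsto_inv_atTop_zero)))
  intro ε hε
  filter_upwards [hlim.eventually (gt_mem_nhds hε), eventually_gt_atTop 0] with R h1 hR x
  rw [integral_correlation_interval hw hv hR.le]
  set V : ℝ → ℝ := fun y => ∫ s in (y - (x + R))..(y - x), v s with hV
  have hb1 : ∀ y, |V y| ≤ C * R := fun y => by
    have := abs_intervalIntegral_le_of_ae hC (y - (x + R)) (y - x)
    rwa [show y - x - (y - (x + R)) = R by ring, abs_of_pos hR] at this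
  have hb2 : ∀ y, |V y - V 0| ≤ 2 * C * |y| := fun y => by
    simp only [hV]
    rw [intervalIntegral.integral_interval_sub_interval_comm (hvi _ _) (hvi _ _) (hvi _ _)]
    refine (abs_sub _ _).trans ?_
    have e1 := abs_intervalIntegral_le_of_ae hC (y - (x + R)) (0 - (x + R))
    have e2 := abs_intervalIntegral_le_of_ae hC (y - x) (0 - x)
    rw [show 0 - (x + R) - (y - (x + R)) = -y by ring, abs_neg] at e1
    rw [show 0 - x - (y - x) = -y by ring, abs_neg] at e2
    linarith
  have hVc : Continuous V := by
    refine Continuous.sub (f := fun y => ∫ s in (0 : ℝ)..(y - x), v s)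
      (g := fun y => ∫ s in (0 : ℝ)..(y - (x + R)), v s) ?_ ?_ |>.congr fun y => ?_
    · exact (intervalIntegral.continuous_primitive hvi 0).comp (by fun_prop)
    · exact (intervalIntegral.continuous_primitive hvi 0).comp (by fun_prop)
    · exact intervalIntegral.integral_interval_sub_left (hvi _ _) (hvi _ _)
  have hwV : Integrable (fun y => w y * V y) volume :=
    hw.mul_bdd (c := C * R) hVc.aestronglyMeasurable (Eventually.of_forall hb1)
  have e : ∫ y, w y * V y = ∫ y, w y * (V y - V 0) := by
    simp only [mul_sub]
    rw [integral_sub hwV (hw.mul_const _), integral_mul_const, hw0, zero_mul, sub_zero]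
  rw [e]
  calc |∫ y, w y * (V y - V 0)| ≤ ∫ y, (|w y| * min (2 * C) (2 * C * |y| * R⁻¹)) * R := by
        rw [← Real.norm_eq_abs]
        refine norm_integral_le_of_norm_le ?_ (Eventually.of_forall fun y => ?_)
        · refine Integrable.mul_const ?_ _
          refine hw.abs.mul_bdd (c := 2 * C) (by fun_prop) (Eventually.of_forall fun y => ?_)
          rw [Real.norm_of_nonneg (by positivity)]
          exact min_le_left _ _
        · rw [norm_mul, mul_assoc, Real.norm_eq_abs, Real.norm_eq_abs]
          gcongr
          rw [min_mul_of_nonneg _ _ hR.le, inv_mul_cancel_right₀ hR.ne']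
          refine le_min ?_ (hb2 y)
          have := (abs_sub (V y) (V 0)).trans (add_le_add (hb1 y) (hb1 0))
          linarith
    _ = (∫ y, |w y| * min (2 * C) (2 * C * |y| * R⁻¹)) * R := integral_mul_const _ _
    _ ≤ ε * R := by gcongr

end Correlation

/-! ### Directions and test functions. -/

noncomputable section

/-- The sign of the direction in which a fractional integral extends. -/
def FracSide.dir : FracSide → ℝ
  | .left => -1
  | .right => 1

lemma FracSide.dir_opp (s : FracSide) : s.opp.dir = -s.dir := by cases s <;> simp [opp, dir]

lemma FracSide.opp_opp (s : FracSide) : s.opp.opp = s := by cases s <;> rfl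

lemma FracSide.dir_eq (s : FracSide) : s.dir = 1 ∨ s.dir = -1 := by cases s <;> simp [dir]

lemma FracSide.abs_dir (s : FracSide) : |s.dir| = 1 := by cases s <;> simp [dir]

/-- Test functions on the line. -/
structure IsTestFunction (φ : ℝ → ℝ) : Prop where
  contDiff : ContDiff ℝ ∞ φ
  hasCompactSupport : HasCompactSupport φ

namespace IsTestFunction

variable {φ : ℝ → ℝ}

lemma continuous (hφ : IsTestFunction φ) : Continuous φ := hφ.contDiff.continuous

lemma differentiable (hφ : IsTestFunction φ) : Differentiable ℝ φ :=
  hφ.contDiff.differentiable (by simp)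

lemma integrable (hφ : IsTestFunction φ) : Integrable φ volume :=
  hφ.continuous.integrable_of_hasCompactSupport hφ.hasCompactSupport

lemma memLp (hφ : IsTestFunction φ) (p : ℝ≥0∞) : MemLp φ p volume :=
  hφ.continuous.memLp_of_hasCompactSupport hφ.hasCompactSupport

lemma deriv (hφ : IsTestFunction φ) : IsTestFunction (deriv φ) :=
  ⟨by simpa using hφ.contDiff.iterate_deriv 1, hφ.hasCompactSupport.deriv⟩

lemma iteratedDeriv (hφ : IsTestFunction φ) (n : ℕ) : IsTestFunction (iteratedDeriv n φ) := by
  induction n with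
  | zero => simpa using hφ
  | succ n ih => rw [iteratedDeriv_succ]; exact ih.deriv

lemma comp_affine (hφ : IsTestFunction φ) {a : ℝ} (ha : a ≠ 0) (b : ℝ) :
    IsTestFunction (fun x => φ (a * x + b)) :=
  ⟨hφ.contDiff.comp (by fun_prop), hφ.hasCompactSupport.comp_homeomorph
    ((Homeomorph.mulLeft₀ a ha).trans (Homeomorph.addRight b))⟩

lemma comp_sub_const (hφ : IsTestFunction φ) (b : ℝ) : IsTestFunction (fun x => φ (x - b)) := by
  simpa [sub_eq_add_neg] using hφ.comp_affine one_ne_zero (-b)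

lemma comp_const_sub (hφ : IsTestFunction φ) (b : ℝ) : IsTestFunction (fun x => φ (b - x)) := by
  simpa [sub_eq_add_neg, add_comm] using hφ.comp_affine (neg_ne_zero.2 one_ne_zero) b

lemma exists_bound (hφ : IsTestFunction φ) : ∃ C, 0 < C ∧ ∀ x, |φ x| ≤ C := by
  obtain ⟨C, hC⟩ := hφ.hasCompactSupport.exists_bound_of_continuous hφ.continuous
  exact ⟨max C 1, by positivity, fun x => (hC x).trans (le_max_left _ _)⟩

lemma exists_support_bound (hφ : IsTestFunction φ) : ∃ B, 0 < B ∧ ∀ x, B < |x| → φ x = 0 := by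
  obtain ⟨B, hB⟩ := hφ.hasCompactSupport.isCompact.isBounded.exists_norm_le
  refine ⟨max B 1, by positivity, fun x hx => image_eq_zero_of_notMem_tsupport fun h => ?_⟩
  exact absurd (hB x h) (not_le.2 ((le_max_left _ _).trans_lt hx))

lemma exists_lipschitz (hφ : IsTestFunction φ) : ∃ C, 0 < C ∧ ∀ x y, |φ x - φ y| ≤ C * |x - y| := by
  obtain ⟨C, hC⟩ := hφ.contDiff.lipschitzWith_of_hasCompactSupport hφ.hasCompactSupport (by simp)
  refine ⟨C + 1, by positivity, fun x y => ?_⟩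
  have := hC.dist_le_mul x y
  rw [Real.dist_eq, Real.dist_eq] at this
  refine this.trans ?_
  gcongr
  simp

end IsTestFunction

/-! ### Fractional derivatives as convolutions. -/

section Kernel

variable {σ : ℝ}

/-- The kernel whose convolution with `f` is, up to a constant, the fractional integral of `f`
of order `1 - σ`. -/
def liouvilleKernel (s : FracSide) (σ z : ℝ) : ℝ :=
  indicator (Ioi 0) (fun t : ℝ => t ^ (-σ)) (-s.dir * z)

lemma locallyIntegrable_indicator_rpow (hσ : σ < 1) :
    LocallyIntegrable (indicator (Ioi 0) fun t : ℝ => t ^ (-σ)) volume := by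
  rw [locallyIntegrable_iff]
  intro k hk
  obtain ⟨B, hB⟩ := hk.isBounded.exists_norm_le
  have hsub : k ⊆ Icc (-|B|) |B| := fun x hx =>
    abs_le.1 ((hB x hx).trans (le_abs_self B))
  refine IntegrableOn.mono_set ?_ hsub
  have h := (intervalIntegral.intervalIntegrable_rpow' (a := -|B|) (b := |B|) (r := -σ)
    (by linarith))
  rw [intervalIntegrable_iff_integrableOn_Icc_of_le (by linarith [abs_nonneg B])] at h
  exact h.indicator measurableSet_Ioi

lemma locallyIntegrable_liouvilleKernel (s : FracSide) (hσ : σ < 1) :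
    LocallyIntegrable (liouvilleKernel s σ) volume := by
  have h := locallyIntegrable_indicator_rpow hσ
  cases s with
  | left =>
    convert h using 1
    ext z; simp [liouvilleKernel, FracSide.dir]
  | right =>
    rw [locallyIntegrable_iff] at h ⊢
    intro k hk
    have h1 := h (Neg.neg '' k) (hk.image continuous_neg)
    rw [(Measure.measurePreserving_neg volume).integrableOn_image
      (Homeomorph.neg ℝ).measurableEmbedding] at h1
    convert h1 using 1
    ext z; simp [liouvilleKernel, FracSide.dir]

open scoped Convolution in
lemma fracIntegral_eq_convolution (s : FracSide) (f : ℝ → ℝ) :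
    fracIntegral s (1 - σ) f = fun x => 1 / Real.Gamma (1 - σ) *
      (liouvilleKernel s σ ⋆[ContinuousLinearMap.mul ℝ ℝ, volume] f) x := by
  ext x
  cases s with
  | left =>
    simp only [fracIntegral, convolution_eq_swap, ContinuousLinearMap.mul_apply']
    rw [← integral_indicator measurableSet_Iio]
    congr 2; ext y
    simp only [liouvilleKernel, FracSide.dir, indicator, mem_Iio, mem_Ioi, neg_neg, one_mul, sub_pos]
    split_ifs with h
    · rw [Real.rpow_neg (by linarith), sub_sub_cancel, div_eq_inv_mul]
    · simp
  | right =>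
    simp only [fracIntegral, convolution_eq_swap, ContinuousLinearMap.mul_apply']
    rw [← integral_indicator measurableSet_Ioi]
    congr 2; ext y
    simp only [liouvilleKernel, FracSide.dir, indicator, mem_Ioi, neg_mul, one_mul, neg_sub, sub_pos]
    split_ifs with h
    · rw [Real.rpow_neg (by linarith), sub_sub_cancel, div_eq_inv_mul]
    · simp

open scoped Convolution in
lemma deriv_liouvilleKernel_convolution (s : FracSide) (hσ : σ < 1) {f : ℝ → ℝ}
    (hf : IsTestFunction f) :
    deriv (liouvilleKernel s σ ⋆[ContinuousLinearMap.mul ℝ ℝ, volume] f) =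
      (liouvilleKernel s σ ⋆[ContinuousLinearMap.mul ℝ ℝ, volume] deriv f) := by
  ext x
  exact (hf.hasCompactSupport.hasDerivAt_convolution_right _
    (locallyIntegrable_liouvilleKernel s hσ) (hf.contDiff.of_le (by simp)) x).deriv

open scoped Convolution in
lemma iteratedDeriv_liouvilleKernel_convolution (s : FracSide) (hσ : σ < 1) {f : ℝ → ℝ}
    (hf : IsTestFunction f) (n : ℕ) :
    iteratedDeriv n (liouvilleKernel s σ ⋆[ContinuousLinearMap.mul ℝ ℝ, volume] f) =
      (liouvilleKernel s σ ⋆[ContinuousLinearMap.mul ℝ ℝ, volume] iteratedDeriv n f) := by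
  induction n with
  | zero => simp
  | succ n ih => rw [iteratedDeriv_succ, ih, deriv_liouvilleKernel_convolution s hσ
      (hf.iteratedDeriv n), iteratedDeriv_succ]

open scoped Convolution in
-- All `⌊α⌋ + 1` derivatives fall on `φ`, since the kernel is only locally integrable. The factor
-- `-s.dir` records the sign in front of `d/dx` on either side.
lemma fracDeriv_eq_convolution (s : FracSide) {α : ℝ} (hα : Int.fract α ≠ 0) {φ : ℝ → ℝ}
    (hφ : IsTestFunction φ) (x : ℝ) :
    fracDeriv s α φ x = -s.dir * (1 / Real.Gamma (1 - Int.fract α) *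
      (liouvilleKernel s (Int.fract α) ⋆[ContinuousLinearMap.mul ℝ ℝ, volume]
        deriv (iteratedDeriv ⌊α⌋₊ φ)) x) := by
  have hσ := Int.fract_lt_one α
  have h : fracDerivUnit s (Int.fract α) φ = fun x => (-s.dir * (1 / Real.Gamma (1 - Int.fract α))) •
      (liouvilleKernel s (Int.fract α) ⋆[ContinuousLinearMap.mul ℝ ℝ, volume] deriv φ) x := by
    ext y
    rw [← deriv_liouvilleKernel_convolution s hσ hφ]
    cases s <;> simp only [fracDerivUnit, fracIntegral_eq_convolution, deriv_const_mul_field,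
      FracSide.dir, smul_eq_mul] <;> ring
  rw [fracDeriv, if_neg hα, h]
  have h2 := iteratedDeriv_const_smul_field (n := ⌊α⌋₊) (x := x)
    (-s.dir * (1 / Real.Gamma (1 - Int.fract α)))
    (liouvilleKernel s (Int.fract α) ⋆[ContinuousLinearMap.mul ℝ ℝ, volume] deriv φ)
  refine h2.trans ?_
  rw [iteratedDeriv_liouvilleKernel_convolution s hσ hφ.deriv, ← iteratedDeriv_succ',
    iteratedDeriv_succ, smul_eq_mul, mul_assoc]

open scoped Convolution in
lemma liouvilleKernel_convolution_eq (s : FracSide) (f : ℝ → ℝ) (x : ℝ) :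
    (liouvilleKernel s σ ⋆[ContinuousLinearMap.mul ℝ ℝ, volume] f) x =
      ∫ t in Ioi 0, f (x + s.dir * t) * t ^ (-σ) := by
  rw [← integral_indicator measurableSet_Ioi]
  simp only [convolution, ContinuousLinearMap.mul_apply', liouvilleKernel]
  cases s with
  | left =>
    congr 1; ext t
    simp only [FracSide.dir, indicator, neg_neg, one_mul, neg_mul, ← sub_eq_add_neg]
    split_ifs <;> ring
  | right =>
    rw [← integral_neg_eq_self]
    congr 1; ext t
    simp only [FracSide.dir, indicator, neg_mul, one_mul, neg_neg, sub_neg_eq_add]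
    split_ifs <;> ring

end Kernel

/-! ### The Marchaud formula. -/

section Marchaud

variable {σ : ℝ}

/-- The Marchaud form of a fractional derivative of order `0 < σ < 1`, up to a constant. -/
def marchaud (d σ : ℝ) (f : ℝ → ℝ) (x : ℝ) : ℝ :=
  ∫ t in Ioi 0, (f x - f (x + d * t)) * t ^ (-1 - σ)

/-- The common dominating function: increments of a bounded Lipschitz function over distance `t` are
at most a multiple of `min 1 t`. -/
lemma integrableOn_min_one_mul_rpow (hσ0 : 0 < σ) (hσ1 : σ < 1) :
    IntegrableOn (fun t : ℝ => min 1 t * t ^ (-1 - σ)) (Ioi 0) volume := by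
  rw [← Ioc_union_Ioi_eq_Ioi zero_le_one, integrableOn_union]
  constructor
  · have h := (intervalIntegral.intervalIntegrable_rpow' (a := 0) (b := 1) (r := -σ)
      (by linarith))
    rw [intervalIntegrable_iff_integrableOn_Ioc_of_le zero_le_one] at h
    refine h.congr_fun (fun t ht => ?_) measurableSet_Ioc
    simp only
    rw [min_eq_right ht.2, show -σ = 1 + (-1 - σ) by ring, Real.rpow_add ht.1, Real.rpow_one]
  · refine (integrableOn_Ioi_rpow_of_lt (a := -1 - σ) (by linarith) one_pos).congr_fun
      (fun t ht => ?_) measurableSet_Ioi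
    simp only
    rw [min_eq_left (le_of_lt ht), one_mul]

lemma IsTestFunction.exists_sub_le_min {f : ℝ → ℝ} (hf : IsTestFunction f) :
    ∃ C, 0 < C ∧ ∀ d x t : ℝ, |d| = 1 → 0 < t → |f x - f (x + d * t)| ≤ C * min 1 t := by
  obtain ⟨C, hC0, hC⟩ := hf.exists_bound
  obtain ⟨L, hL0, hL⟩ := hf.exists_lipschitz
  refine ⟨max (2 * C) L, by positivity, fun d x t hd ht => ?_⟩
  rw [mul_min_of_nonneg _ _ (by positivity)]
  refine le_min ?_ ?_
  · have := abs_sub (f x) (f (x + d * t))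
    have := hC x
    have := hC (x + d * t)
    have := le_max_left (2 * C) L
    linarith
  · have h := hL x (x + d * t)
    rw [show x - (x + d * t) = -(d * t) by ring, abs_neg, abs_mul, hd, one_mul, abs_of_pos ht] at h
    refine h.trans ?_
    gcongr
    exact le_max_right _ _

/-- Integration by parts in `t`, with the primitive `f x - f (x + d * t)` chosen to vanish at `t =
0`. The boundary terms are then of size `t ^ (1 - σ)` at zero and `t ^ (-σ)` at infinity. -/
lemma neg_dir_mul_integral_deriv_eq_marchaud {d : ℝ} (hd : d = 1 ∨ d = -1) (hσ0 : 0 < σ)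
    (hσ1 : σ < 1) {f : ℝ → ℝ} (hf : IsTestFunction f) (x : ℝ) :
    -d * ∫ t in Ioi 0, deriv f (x + d * t) * t ^ (-σ) = σ * marchaud d σ f x := by
  have hdabs : |d| = 1 := by rcases hd with rfl | rfl <;> simp
  obtain ⟨C, hC0, hC⟩ := hf.exists_sub_le_min
  have hu : ∀ t ∈ Ioi (0 : ℝ), HasDerivAt (fun t : ℝ => t ^ (-σ)) (-σ * t ^ (-σ - 1)) t :=
    fun t ht => Real.hasDerivAt_rpow_const (Or.inl (ne_of_gt ht))
  have hv : ∀ t ∈ Ioi (0 : ℝ), HasDerivAt (fun t => f x - f (x + d * t))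
      (-(deriv f (x + d * t) * d)) t := fun t _ => by
    have h1 : HasDerivAt (fun t => x + d * t) d t := by
      simpa using ((hasDerivAt_id t).const_mul d).const_add x
    have h2 := (hf.differentiable (x + d * t)).hasDerivAt.comp t h1
    exact h2.const_sub (f x)
  have hle : ∀ t ∈ Ioi (0 : ℝ), |f x - f (x + d * t)| ≤ C * min 1 t := fun t ht => hC d x t hdabs ht
  have hint : IntegrableOn (fun t => deriv f (x + d * t) * t ^ (-σ)) (Ioi 0) volume := by
    obtain ⟨B, hB0, hB⟩ := hf.deriv.exists_support_bound
    obtain ⟨C', -, hC'⟩ := hf.deriv.exists_bound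
    have hz : ∀ t, B + |x| < t → deriv f (x + d * t) = 0 := fun t ht => by
      apply hB
      have h1 : |d * t| ≤ |x + d * t| + |x| := by
        have := abs_sub (x + d * t) x
        rwa [add_sub_cancel_left] at this
      rw [abs_mul, hdabs, one_mul] at h1
      linarith [le_abs_self t]
    rw [← Ioc_union_Ioi_eq_Ioi (show 0 ≤ B + |x| by positivity), integrableOn_union]
    constructor
    · have h := (intervalIntegral.intervalIntegrable_rpow' (a := 0) (b := B + |x|) (r := -σ)
        (by linarith))
      rw [intervalIntegrable_iff_integrableOn_Ioc_of_le (by positivity)] at h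
      refine h.bdd_mul (c := C') ?_ (Eventually.of_forall fun t => hC' _)
      exact (hf.deriv.continuous.comp (by fun_prop)).aestronglyMeasurable
    · exact integrableOn_zero.congr_fun (fun t ht => by simp [hz t ht]) measurableSet_Ioi
  have hint2 : IntegrableOn (fun t => (f x - f (x + d * t)) * t ^ (-1 - σ)) (Ioi 0) volume := by
    refine ((integrableOn_min_one_mul_rpow hσ0 hσ1).const_mul C).mono' ?_ ?_
    · refine AEStronglyMeasurable.mul ?_ (by fun_prop)
      exact (continuous_const.sub (hf.continuous.comp (by fun_prop))).aestronglyMeasurable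
    · refine (ae_restrict_iff' measurableSet_Ioi).2 (Eventually.of_forall fun t ht => ?_)
      rw [norm_mul, Real.norm_of_nonneg (Real.rpow_nonneg (le_of_lt ht) _), ← mul_assoc]
      gcongr
      · exact Real.rpow_nonneg (le_of_lt ht) _
      · exact hle t ht
  have key := integral_Ioi_mul_deriv_eq_deriv_mul (a' := 0) (b' := 0) hu hv
    (hint.mul_const (-d) |>.congr (Eventually.of_forall fun t => by simp [Pi.mul_apply]; ring))
    (hint2.const_mul (-σ) |>.congr (Eventually.of_forall fun t => by
      simp only [Pi.mul_apply]; rw [show -σ - 1 = -1 - σ by ring]; ring)) ?_ ?_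
  · have e1 : ∫ t in Ioi 0, t ^ (-σ) * -(deriv f (x + d * t) * d) =
        -d * ∫ t in Ioi 0, deriv f (x + d * t) * t ^ (-σ) := by
      rw [← integral_const_mul]; congr 1; ext t; ring
    have e2 : ∫ t in Ioi 0, -σ * t ^ (-σ - 1) * (f x - f (x + d * t)) = -σ * marchaud d σ f x := by
      rw [marchaud, ← integral_const_mul]; congr 1; ext t
      rw [show -σ - 1 = -1 - σ by ring]; ring
    rw [← e1, key, e2]; ring
  · have hlim : Tendsto (fun t : ℝ => C * t ^ (1 - σ)) (𝓝[>] 0) (𝓝 0) := by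
      have : Tendsto (fun t : ℝ => C * t ^ (1 - σ)) (𝓝[>] 0) (𝓝 (C * 0 ^ (1 - σ))) :=
        ((Real.continuousAt_rpow_const 0 (1 - σ) (Or.inr (by linarith))).tendsto.const_mul
          C).mono_left nhdsWithin_le_nhds
      rwa [Real.zero_rpow (by linarith), mul_zero] at this
    refine squeeze_zero_norm' ?_ hlim
    filter_upwards [self_mem_nhdsWithin] with t ht
    simp only [Pi.mul_apply, norm_mul]
    rw [Real.norm_of_nonneg (Real.rpow_nonneg (le_of_lt ht) _)]
    calc t ^ (-σ) * ‖f x - f (x + d * t)‖ ≤ t ^ (-σ) * (C * t) := by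
          have := (hle t ht).trans (mul_le_mul_of_nonneg_left (min_le_right 1 t) hC0.le)
          have h0 := Real.rpow_nonneg (le_of_lt ht) (-σ)
          gcongr
          exact this
      _ = C * t ^ (1 - σ) := by
          rw [show 1 - σ = 1 + -σ by ring, Real.rpow_add ht, Real.rpow_one]; ring
  · have hlim : Tendsto (fun t : ℝ => C * t ^ (-σ)) atTop (𝓝 0) := by
      simpa using (tendsto_rpow_neg_atTop hσ0).const_mul C
    refine squeeze_zero_norm' ?_ hlim
    filter_upwards [eventually_gt_atTop 0] with t ht
    simp only [Pi.mul_apply, norm_mul]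
    rw [Real.norm_of_nonneg (Real.rpow_nonneg ht.le _), mul_comm]
    have h0 := Real.rpow_nonneg ht.le (-σ)
    gcongr
    exact (hle t ht).trans (mul_le_of_le_one_right hC0.le (min_le_left _ _))

/-- The Marchaud formula for the fractional derivative of a test function. -/
lemma fracDeriv_eq_marchaud (s : FracSide) {α : ℝ} (hα : Int.fract α ≠ 0) {φ : ℝ → ℝ}
    (hφ : IsTestFunction φ) (x : ℝ) :
    fracDeriv s α φ x = Int.fract α / Real.Gamma (1 - Int.fract α) *
      marchaud s.dir (Int.fract α) (iteratedDeriv ⌊α⌋₊ φ) x := by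
  have h := neg_dir_mul_integral_deriv_eq_marchaud s.dir_eq
    ((Int.fract_nonneg α).lt_of_ne' hα) (Int.fract_lt_one α) (hφ.iteratedDeriv ⌊α⌋₊) x
  rw [fracDeriv_eq_convolution s hα hφ, liouvilleKernel_convolution_eq, mul_left_comm, h]
  ring

end Marchaud

end

/-! ### Integrability and symmetries of fractional derivatives of test functions. -/

section FracDerivProperties

variable {σ d : ℝ}

lemma IsTestFunction.exists_integral_sub_le_min {f : ℝ → ℝ} (hf : IsTestFunction f) :
    ∃ C, ∀ d t : ℝ, |d| = 1 → 0 < t → ∫ x, ‖f x - f (x + d * t)‖ ≤ C * min 1 t := by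
  obtain ⟨C, hC0, hC⟩ := hf.exists_sub_le_min
  obtain ⟨B, hB0, hB⟩ := hf.exists_support_bound
  -- The first entry serves `t ≤ 1`, where the difference is supported in `[-(B + 1), B + 1]`. The
  -- second serves `t ≥ 1`, by the triangle inequality.
  refine ⟨max (C * (2 * (B + 1))) (2 * ∫ x, ‖f x‖), fun d t hd ht => ?_⟩
  rcases le_total t 1 with h1 | h1
  · have hle : ∀ x, ‖f x - f (x + d * t)‖ ≤
        indicator (Icc (-(B + 1)) (B + 1)) (fun _ => C * min 1 t) x := fun x => by
      by_cases hx : x ∈ Icc (-(B + 1)) (B + 1)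
      · rw [indicator_of_mem hx]
        exact hC d x t hd ht
      · rw [indicator_of_notMem hx]
        have hx' : B + 1 < |x| := not_le.1 fun h => hx (abs_le.1 h)
        have h2 : |x| - |d * t| ≤ |x + d * t| := by
          have := abs_sub_abs_le_abs_sub x (-(d * t))
          rwa [abs_neg, sub_neg_eq_add] at this
        rw [abs_mul, hd, one_mul, abs_of_pos ht] at h2
        rw [hB x (by linarith), hB (x + d * t) (by linarith)]
        simp
    refine (integral_mono_of_nonneg (Eventually.of_forall fun x => norm_nonneg _)
      ((integrable_indicator_iff measurableSet_Icc).2 continuous_const.integrableOn_Icc)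
      (Eventually.of_forall hle)).trans ?_
    rw [integral_indicator measurableSet_Icc, setIntegral_const, smul_eq_mul, measureReal_def,
      Real.volume_Icc, ENNReal.toReal_ofReal (by linarith)]
    calc (B + 1 - -(B + 1)) * (C * min 1 t) = C * (2 * (B + 1)) * min 1 t := by ring
      _ ≤ _ := by gcongr; exact le_max_left _ _
  · rw [min_eq_left h1, mul_one]
    refine le_trans ?_ (le_max_right _ _)
    have hi := hf.integrable.norm
    have hi2 : Integrable (fun x => ‖f (x + d * t)‖) volume := hi.comp_add_right (d * t)
    refine (integral_mono_of_nonneg (Eventually.of_forall fun x => norm_nonneg _)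
      (hi.add hi2) (Eventually.of_forall fun x => norm_sub_le _ _)).trans ?_
    simp only [Pi.add_apply]
    rw [integral_add hi hi2, integral_add_right_eq_self (fun x => ‖f x‖), two_mul]

lemma integrable_marchaud_integrand (hσ0 : 0 < σ) (hσ1 : σ < 1) (hd : |d| = 1) {f : ℝ → ℝ}
    (hf : IsTestFunction f) :
    Integrable (fun P : ℝ × ℝ => (f P.1 - f (P.1 + d * P.2)) * P.2 ^ (-1 - σ))
      (volume.prod (volume.restrict (Ioi 0))) := by
  obtain ⟨C, hC⟩ := hf.exists_integral_sub_le_min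
  have hfc := hf.continuous
  have hm : AEStronglyMeasurable (fun P : ℝ × ℝ => (f P.1 - f (P.1 + d * P.2)) * P.2 ^ (-1 - σ))
      (volume.prod (volume.restrict (Ioi 0))) := by
    refine AEStronglyMeasurable.mul ?_ ?_
    · exact (show Continuous fun P : ℝ × ℝ => f P.1 - f (P.1 + d * P.2) by
        fun_prop).aestronglyMeasurable
    · exact (measurable_snd.pow_const _).aestronglyMeasurable
  rw [integrable_prod_iff' hm]
  constructor
  · exact Eventually.of_forall fun t =>
      (hf.integrable.sub (hf.integrable.comp_add_right (d * t))).mul_const (t ^ (-1 - σ))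
  · refine ((integrableOn_min_one_mul_rpow hσ0 hσ1).const_mul C).mono'
      hm.norm.prod_swap.integral_prod_right' ?_
    refine (ae_restrict_iff' measurableSet_Ioi).2 (Eventually.of_forall fun t ht => ?_)
    have h0 := Real.rpow_nonneg (le_of_lt ht) (-1 - σ)
    rw [Real.norm_of_nonneg (integral_nonneg fun _ => norm_nonneg _)]
    simp only [norm_mul, integral_mul_const, Real.norm_of_nonneg h0]
    rw [← mul_assoc]
    gcongr
    exact hC d t hd ht

lemma integrable_marchaud (hσ0 : 0 < σ) (hσ1 : σ < 1) (hd : |d| = 1) {f : ℝ → ℝ}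
    (hf : IsTestFunction f) : Integrable (marchaud d σ f) volume :=
  (integrable_marchaud_integrand hσ0 hσ1 hd hf).integral_prod_left

lemma exists_bound_marchaud (hσ0 : 0 < σ) (hσ1 : σ < 1) (hd : |d| = 1) {f : ℝ → ℝ}
    (hf : IsTestFunction f) : ∃ C, ∀ x, |marchaud d σ f x| ≤ C := by
  obtain ⟨C, hC0, hC⟩ := hf.exists_sub_le_min
  refine ⟨∫ t in Ioi 0, C * (min 1 t * t ^ (-1 - σ)), fun x => ?_⟩
  rw [← Real.norm_eq_abs]
  refine norm_integral_le_of_norm_le ((integrableOn_min_one_mul_rpow hσ0 hσ1).const_mul C) ?_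
  refine (ae_restrict_iff' measurableSet_Ioi).2 (Eventually.of_forall fun t ht => ?_)
  have h0 := Real.rpow_nonneg (le_of_lt ht) (-1 - σ)
  rw [norm_mul, Real.norm_of_nonneg h0, ← mul_assoc]
  gcongr
  exact hC d x t hd ht

variable (s : FracSide) {α : ℝ} {φ : ℝ → ℝ}

lemma fract_pos_of_ne_zero (h : Int.fract α ≠ 0) : 0 < Int.fract α :=
  (Int.fract_nonneg α).lt_of_ne' h

lemma fracDeriv_of_fract_eq_zero (h : Int.fract α = 0) (φ : ℝ → ℝ) :
    fracDeriv s α φ = iteratedDeriv ⌊α⌋₊ φ := if_pos h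

lemma fracDeriv_eq_marchaud' (h : Int.fract α ≠ 0) (hφ : IsTestFunction φ) :
    fracDeriv s α φ = fun x => Int.fract α / Real.Gamma (1 - Int.fract α) *
      marchaud s.dir (Int.fract α) (iteratedDeriv ⌊α⌋₊ φ) x :=
  funext (fracDeriv_eq_marchaud s h hφ)

lemma integrable_fracDeriv (hφ : IsTestFunction φ) : Integrable (fracDeriv s α φ) volume := by
  by_cases h : Int.fract α = 0
  · rw [fracDeriv_of_fract_eq_zero s h]
    exact (hφ.iteratedDeriv _).integrable
  · rw [fracDeriv_eq_marchaud' s h hφ]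
    exact (integrable_marchaud (fract_pos_of_ne_zero h) (Int.fract_lt_one α) s.abs_dir
      (hφ.iteratedDeriv _)).const_mul _

lemma exists_bound_fracDeriv (hφ : IsTestFunction φ) : ∃ C, ∀ x, |fracDeriv s α φ x| ≤ C := by
  by_cases h : Int.fract α = 0
  · rw [fracDeriv_of_fract_eq_zero s h]
    obtain ⟨C, -, hC⟩ := (hφ.iteratedDeriv ⌊α⌋₊).exists_bound
    exact ⟨C, hC⟩
  · obtain ⟨C, hC⟩ := exists_bound_marchaud (fract_pos_of_ne_zero h) (Int.fract_lt_one α) s.abs_dir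
      (hφ.iteratedDeriv ⌊α⌋₊)
    refine ⟨|Int.fract α / Real.Gamma (1 - Int.fract α)| * C, fun x => ?_⟩
    rw [fracDeriv_eq_marchaud s h hφ, abs_mul]
    gcongr
    exact hC x

lemma memLp_top_fracDeriv (hφ : IsTestFunction φ) : MemLp (fracDeriv s α φ) ⊤ volume := by
  obtain ⟨C, hC⟩ := exists_bound_fracDeriv s (α := α) hφ
  exact memLp_top_of_bound (integrable_fracDeriv s hφ).1 C (Eventually.of_forall hC)

lemma memLp_fracDeriv (hφ : IsTestFunction φ) {p : ℝ≥0∞} (hp : 1 ≤ p) :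
    MemLp (fracDeriv s α φ) p volume := by
  obtain ⟨C, hC⟩ := exists_bound_fracDeriv s (α := α) hφ
  -- After division by `D` the function equals its own small part, so integrability passes to every
  -- larger exponent.
  set D := max C 1 with hD
  have hD0 : 0 < D := by positivity
  have h1 : MemLp (fun x => D⁻¹ * fracDeriv s α φ x) 1 volume :=
    memLp_one_iff_integrable.2 ((integrable_fracDeriv s hφ).const_mul _)
  have h2 := (memLp_smallPart h1 le_rfl hp).const_mul D
  refine h2.ae_eq (Eventually.of_forall fun x => ?_)
  have h3 : |D⁻¹ * fracDeriv s α φ x| ≤ 1 := by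
    rw [abs_mul, abs_of_pos (inv_pos.2 hD0), inv_mul_le_iff₀ hD0, mul_one]
    exact (hC x).trans (le_max_left _ _)
  simp only [smallPart, if_pos h3]
  rw [mul_inv_cancel_left₀ hD0.ne']

lemma fracDeriv_comp_sub_const (hφ : IsTestFunction φ) (b x : ℝ) :
    fracDeriv s α (fun z => φ (z - b)) x = fracDeriv s α φ (x - b) := by
  by_cases h : Int.fract α = 0
  · rw [fracDeriv_of_fract_eq_zero s h, fracDeriv_of_fract_eq_zero s h,
      iteratedDeriv_comp_sub_const]
  · rw [fracDeriv_eq_marchaud s h hφ, fracDeriv_eq_marchaud s h (hφ.comp_sub_const b),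
      iteratedDeriv_comp_sub_const]
    simp only [marchaud, sub_add_eq_add_sub]

/-- Each of the `⌊α⌋` outer derivatives contributes a sign, while the Marchaud integral only changes
direction. -/
lemma fracDeriv_comp_neg (hφ : IsTestFunction φ) (x : ℝ) :
    fracDeriv s α (fun z => φ (-z)) x = (-1) ^ ⌊α⌋₊ * fracDeriv s.opp α φ (-x) := by
  have hφ' : IsTestFunction (fun z => φ (-z)) := by simpa using hφ.comp_const_sub 0
  have e : ∀ y, iteratedDeriv ⌊α⌋₊ (fun z => φ (-z)) y =
      (-1) ^ ⌊α⌋₊ * iteratedDeriv ⌊α⌋₊ φ (-y) := fun y => by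
    rw [iteratedDeriv_comp_neg, smul_eq_mul]
  by_cases h : Int.fract α = 0
  · rw [fracDeriv_of_fract_eq_zero s h, fracDeriv_of_fract_eq_zero _ h, e]
  · rw [fracDeriv_eq_marchaud s h hφ', fracDeriv_eq_marchaud _ h hφ, mul_left_comm]
    congr 1
    simp only [marchaud, e]
    rw [← integral_const_mul]
    congr 1; ext t
    rw [FracSide.dir_opp, neg_add, neg_mul]
    ring

/-- The ordinary derivatives give `c ^ ⌊α⌋`, and substituting `c * t` in the Marchaud integral gives
`c ^ σ` with `σ` the fractional part. -/
lemma fracDeriv_comp_mul (hα : 0 < α) (hφ : IsTestFunction φ) {c : ℝ} (hc : 0 < c) (x : ℝ) :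
    fracDeriv s α (fun z => φ (c * z)) x = c ^ α * fracDeriv s α φ (c * x) := by
  have hφ' : IsTestFunction (fun z => φ (c * z)) := by simpa using hφ.comp_affine hc.ne' 0
  have e : iteratedDeriv ⌊α⌋₊ (fun z => φ (c * z)) =
      fun y => c ^ ⌊α⌋₊ * iteratedDeriv ⌊α⌋₊ φ (c * y) :=
    iteratedDeriv_comp_const_mul (hφ.contDiff.of_le (by exact_mod_cast le_top)) c
  have hfl : α = ⌊α⌋₊ + Int.fract α := by
    rw [natCast_floor_eq_intCast_floor hα.le, Int.floor_add_fract]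
  by_cases h : Int.fract α = 0
  · rw [fracDeriv_of_fract_eq_zero s h, fracDeriv_of_fract_eq_zero _ h, e]
    rw [h, add_zero] at hfl
    conv_rhs => rw [hfl]
    rw [Real.rpow_natCast, ← hfl]
  · rw [fracDeriv_eq_marchaud s h hφ', fracDeriv_eq_marchaud _ h hφ, mul_left_comm]
    congr 1
    set σ := Int.fract α
    rw [e]
    have h1 := integral_comp_mul_left_Ioi (fun t => (iteratedDeriv ⌊α⌋₊ φ (c * x) -
      iteratedDeriv ⌊α⌋₊ φ (c * x + s.dir * t)) * t ^ (-1 - σ)) 0 hc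
    rw [mul_zero, smul_eq_mul] at h1
    have h2 : marchaud s.dir σ (iteratedDeriv ⌊α⌋₊ φ) (c * x) =
        c * ∫ t in Ioi 0, (iteratedDeriv ⌊α⌋₊ φ (c * x) -
          iteratedDeriv ⌊α⌋₊ φ (c * x + s.dir * (c * t))) * (c * t) ^ (-1 - σ) := by
      rw [h1, mul_inv_cancel_left₀ hc.ne']; rfl
    rw [h2, marchaud, ← integral_const_mul, ← integral_const_mul]
    refine setIntegral_congr_fun measurableSet_Ioi fun t ht => ?_
    rw [Real.mul_rpow hc.le (le_of_lt ht), show c * (x + s.dir * t) = c * x + s.dir * (c * t) by ring]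
    have h3 : c ^ α * (c * c ^ (-1 - σ)) = c ^ ⌊α⌋₊ := by
      rw [← Real.rpow_one_add' hc.le, ← Real.rpow_add hc, ← Real.rpow_natCast]
      · congr 1; linarith
      · have := fract_pos_of_ne_zero h; simp only [σ]; linarith
    rw [← h3]
    ring

end FracDerivProperties

/-! ### A maximum principle for the Marchaud derivative. -/

section MaximumPrinciple

variable {σ d : ℝ} {F : ℝ → ℝ}

lemma HasNullAverages.eventually_dir (hF : HasNullAverages F) (hd : d = 1 ∨ d = -1) {ε : ℝ}
    (hε : 0 < ε) :
    ∀ᶠ R : ℝ in atTop, ∀ x, |∫ t in (0 : ℝ)..R, F (x + d * t)| ≤ ε * R := by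
  rcases hd with rfl | rfl
  · simpa using hF ε hε
  · filter_upwards [hF.comp_neg ε hε] with R hR x
    refine le_of_eq_of_le ?_ (hR (-x))
    congr 2; ext t; congr 1; ring

/-- A bounded Lipschitz function with null averages and vanishing Marchaud derivative is
nonpositive: at points where it is close to its supremum it has to be so on a long interval. -/
lemma nonpos_of_marchaud_eq_zero (hσ0 : 0 < σ) (hσ1 : σ < 1) (hd : d = 1 ∨ d = -1)
    (hFc : Continuous F) {C : ℝ} (hC : ∀ x, |F x| ≤ C)
    (hmin : ∀ x t : ℝ, 0 < t → |F x - F (x + d * t)| ≤ C * min 1 t)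
    (hF : HasNullAverages F) (h0 : ∀ x, marchaud d σ F x = 0) (x : ℝ) : F x ≤ 0 := by
  by_contra! hx
  have hbdd : BddAbove (range F) := ⟨C, by rintro _ ⟨y, rfl⟩; exact (le_abs_self _).trans (hC y)⟩
  set M := sSup (range F) with hM
  have hleM : ∀ y, F y ≤ M := fun y => le_csSup hbdd (mem_range_self y)
  have hM0 : 0 < M := hx.trans_le (hleM x)
  have hC0 : 0 ≤ C := (abs_nonneg _).trans (hC x)
  obtain ⟨u, -, hu, hur⟩ := exists_seq_tendsto_sSup (range_nonempty F) hbdd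
  choose y hy using hur
  -- On this fixed length the averages of `F` stay below `M / 2`, which near-maximum points will
  -- contradict.
  obtain ⟨R, hR, hR0⟩ :=
    ((hF.eventually_dir hd (half_pos hM0)).and (eventually_gt_atTop 0)).exists
  have hker := integrableOn_min_one_mul_rpow hσ0 hσ1
  have hkpos : ∀ t ∈ Ioi (0 : ℝ), 0 ≤ t ^ (-1 - σ) := fun t ht => Real.rpow_nonneg (le_of_lt ht) _
  -- A correction making the Marchaud integrand at `y n` nonnegative. The bound `M - u n` alone
  -- would not be integrable against the kernel at zero, hence the second entry. The corrections
  -- tend to zero by dominated convergence.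
  set N : ℕ → ℝ → ℝ := fun n t => min (M - u n) (C * min 1 t) with hN
  have hMu : ∀ n, 0 ≤ M - u n := fun n => by rw [← hy n]; linarith [hleM (y n)]
  have hN0 : ∀ n, ∀ t ∈ Ioi (0 : ℝ), 0 ≤ N n t := fun n t ht =>
    le_min (hMu n) (mul_nonneg hC0 (le_min zero_le_one (le_of_lt ht)))
  have hNle : ∀ n, ∀ t ∈ Ioi (0 : ℝ),
      ‖N n t * t ^ (-1 - σ)‖ ≤ C * (min 1 t * t ^ (-1 - σ)) := fun n t ht => by
    rw [norm_mul, Real.norm_of_nonneg (hN0 n t ht), Real.norm_of_nonneg (hkpos t ht), ← mul_assoc]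
    have := hkpos t ht
    gcongr
    exact min_le_right _ _
  have hNm : ∀ n, AEStronglyMeasurable (fun t => N n t * t ^ (-1 - σ))
      (volume.restrict (Ioi 0)) := fun n => by
    refine AEStronglyMeasurable.mul (Continuous.aestronglyMeasurable ?_) (by fun_prop)
    simp only [hN]; fun_prop
  have hNint : ∀ n, IntegrableOn (fun t => N n t * t ^ (-1 - σ)) (Ioi 0) volume := fun n =>
    (hker.const_mul C).mono' (hNm n)
      ((ae_restrict_iff' measurableSet_Ioi).2 (Eventually.of_forall (hNle n)))
  have hlim : Tendsto (fun n => ∫ t in Ioi 0, N n t * t ^ (-1 - σ)) atTop (𝓝 0) := by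
    suffices h : Tendsto (fun n => ∫ t in Ioi 0, N n t * t ^ (-1 - σ)) atTop
        (𝓝 (∫ t in Ioi (0 : ℝ), 0 * t ^ (-1 - σ))) by
      simpa only [zero_mul, integral_zero] using h
    refine tendsto_integral_of_dominated_convergence _ hNm (hker.const_mul C)
      (fun n => (ae_restrict_iff' measurableSet_Ioi).2 (Eventually.of_forall (hNle n))) ?_
    refine (ae_restrict_iff' measurableSet_Ioi).2 (Eventually.of_forall fun t ht => ?_)
    refine Tendsto.mul_const _ ?_
    have h1 : Tendsto (fun n => min (M - u n) (C * min 1 t)) atTop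
        (𝓝 (min (M - M) (C * min 1 t))) := (hu.const_sub M).min tendsto_const_nhds
    rwa [sub_self, min_eq_left (mul_nonneg hC0 (le_min zero_le_one (le_of_lt ht)))] at h1
  -- The differences integrate to zero, so the corrected integral equals that of `N n`. It is
  -- bounded below by its part over `(0, R]`, where the kernel is at least `R ^ (-1 - σ)`.
  have hmain : ∀ n, R ^ (-1 - σ) * (R * u n - M / 2 * R) ≤
      ∫ t in Ioi 0, N n t * t ^ (-1 - σ) := fun n => by
    set h : ℝ → ℝ := fun t => F (y n) - F (y n + d * t) with hh
    have hhc : Continuous h := by simp only [hh]; fun_prop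
    have hhint : IntegrableOn (fun t => h t * t ^ (-1 - σ)) (Ioi 0) volume := by
      refine (hker.const_mul C).mono'
        (hhc.aestronglyMeasurable.mul (by fun_prop)) ?_
      refine (ae_restrict_iff' measurableSet_Ioi).2 (Eventually.of_forall fun t ht => ?_)
      rw [norm_mul, Real.norm_of_nonneg (hkpos t ht), ← mul_assoc]
      have := hkpos t ht
      gcongr
      exact hmin _ _ ht
    have hh0 : ∫ t in Ioi 0, h t * t ^ (-1 - σ) = 0 := h0 (y n)
    have hPnn : ∀ t ∈ Ioi (0 : ℝ), 0 ≤ h t + N n t := fun t ht => by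
      have h1 := neg_le_of_abs_le (hmin (y n) t ht)
      have h2 : -(M - u n) ≤ h t := by
        simp only [hh, ← hy n]; linarith [hleM (y n + d * t)]
      have : -N n t ≤ h t := by
        simp only [hN]
        rcases min_choice (M - u n) (C * min 1 t) with h3 | h3 <;> rw [h3]
        · exact h2
        · exact h1
      linarith
    have e1 : ∫ t in Ioi 0, N n t * t ^ (-1 - σ) = ∫ t in Ioi 0, (h t + N n t) * t ^ (-1 - σ) := by
      simp only [add_mul]
      rw [integral_add hhint (hNint n), hh0, zero_add]
    have hPint : IntegrableOn (fun t => (h t + N n t) * t ^ (-1 - σ)) (Ioi 0) volume := by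
      simp only [add_mul]
      exact hhint.add (hNint n)
    have e2 : ∫ t in (0 : ℝ)..R, h t = R * u n - ∫ t in (0 : ℝ)..R, F (y n + d * t) := by
      simp only [hh]
      rw [intervalIntegral.integral_sub (by simp)
        ((show Continuous fun t => F (y n + d * t) by fun_prop).intervalIntegrable _ _)]
      simp [hy n]
    have e3 : R * u n - M / 2 * R ≤ ∫ t in (0 : ℝ)..R, h t := by
      rw [e2]; linarith [le_of_abs_le (hR (y n))]
    rw [e1]
    have hsub : Ioc 0 R ⊆ Ioi (0 : ℝ) := Ioc_subset_Ioi_self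
    calc R ^ (-1 - σ) * (R * u n - M / 2 * R) ≤ R ^ (-1 - σ) * ∫ t in (0 : ℝ)..R, h t := by
          have := Real.rpow_nonneg hR0.le (-1 - σ)
          gcongr
      _ = ∫ t in Ioc 0 R, R ^ (-1 - σ) * h t := by
          rw [intervalIntegral.integral_of_le hR0.le, integral_const_mul]
      _ ≤ ∫ t in Ioc 0 R, (h t + N n t) * t ^ (-1 - σ) := by
          refine setIntegral_mono_on ?_ (hPint.mono_set hsub) measurableSet_Ioc fun t ht => ?_
          · exact ((hhc.integrableOn_Icc).mono_set Ioc_subset_Icc_self).const_mul _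
          · rw [mul_comm]
            have hk : R ^ (-1 - σ) ≤ t ^ (-1 - σ) :=
              Real.rpow_le_rpow_of_nonpos ht.1 ht.2 (by linarith)
            have h1 := hPnn t ht.1
            calc h t * R ^ (-1 - σ) ≤ (h t + N n t) * R ^ (-1 - σ) := by
                  have := Real.rpow_nonneg hR0.le (-1 - σ)
                  have := hN0 n t ht.1
                  gcongr
                  linarith
              _ ≤ _ := by gcongr
      _ ≤ ∫ t in Ioi 0, (h t + N n t) * t ^ (-1 - σ) := by
          refine setIntegral_mono_set hPint ?_ hsub.eventuallyLE
          exact (ae_restrict_iff' measurableSet_Ioi).2 (Eventually.of_forall fun t ht =>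
            mul_nonneg (hPnn t ht) (hkpos t ht))
  have hlim2 : Tendsto (fun n => R ^ (-1 - σ) * (R * u n - M / 2 * R)) atTop
      (𝓝 (R ^ (-1 - σ) * (R * M - M / 2 * R))) :=
    ((hu.const_mul R).sub_const _).const_mul _
  have h1 := le_of_tendsto_of_tendsto' hlim2 hlim hmain
  have h2 : 0 < R ^ (-1 - σ) * (R * M - M / 2 * R) := by
    have : 0 < R * M - M / 2 * R := by nlinarith [mul_pos hR0 hM0]
    positivity
  linarith

lemma eq_zero_of_marchaud_eq_zero (hσ0 : 0 < σ) (hσ1 : σ < 1) (hd : d = 1 ∨ d = -1)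
    (hFc : Continuous F) {C : ℝ} (hC : ∀ x, |F x| ≤ C)
    (hmin : ∀ x t : ℝ, 0 < t → |F x - F (x + d * t)| ≤ C * min 1 t)
    (hF : HasNullAverages F) (h0 : ∀ x, marchaud d σ F x = 0) (x : ℝ) : F x = 0 := by
  refine le_antisymm (nonpos_of_marchaud_eq_zero hσ0 hσ1 hd hFc hC hmin hF h0 x) ?_
  have e : ∀ a b : ℝ, -a - -b = -(a - b) := fun a b => by ring
  have h := nonpos_of_marchaud_eq_zero (F := fun x => -F x) hσ0 hσ1 hd hFc.neg (C := C)
    (fun x => by rw [abs_neg]; exact hC x)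
    (fun x t ht => by rw [e, abs_neg]; exact hmin x t ht)
    (fun ε hε => (hF ε hε).mono fun R hR x => by
      rw [intervalIntegral.integral_neg, abs_neg]; exact hR x)
    (fun x => by
      have := h0 x
      simp only [marchaud, e, neg_mul, integral_neg] at this ⊢
      rw [this, neg_zero]) x
  linarith

end MaximumPrinciple

/-! ### A Liouville theorem for fractional derivatives. -/

section Liouville

variable {E f : ℝ → ℝ}

lemma hasDerivAt_correlation (hE : MemLp E ⊤ volume) (hf : IsTestFunction f) (x : ℝ) :
    HasDerivAt (correlation E f) (-correlation E (deriv f) x) x := by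
  have h := hf.hasCompactSupport.hasDerivAt_convolution_right (ContinuousLinearMap.mul ℝ ℝ)
    (locallyIntegrable_comp_neg le_top hE) (hf.contDiff.of_le (by simp)) (-x)
  have h2 := h.scomp x (hasDerivAt_neg x)
  rw [← correlation_eq_convolution, ← correlation_eq_convolution, ← correlation_swap] at h2
  rw [show correlation E f = correlation f E ∘ Neg.neg from funext fun y => correlation_swap _ _ _]
  simpa using h2

/-- By Fubini an average of the correlation is an `f`-weighted integral of averages of `E`, which
are small uniformly in position. -/
lemma hasNullAverages_correlation_of_bounded (hEc : Continuous E) {C : ℝ} (hC : ∀ x, |E x| ≤ C)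
    (hE : HasNullAverages E) (hf : IsTestFunction f) : HasNullAverages (correlation E f) := by
  intro ε hε
  set A := ∫ z, |f z| with hA
  have hA0 : 0 ≤ A := integral_nonneg fun _ => abs_nonneg _
  filter_upwards [hE (ε / (A + 1)) (by positivity), eventually_ge_atTop 0] with R hR hR0 x
  have hint : Integrable (Function.uncurry fun t z => E (z + (x + t)) * f z)
      ((volume.restrict (Ioc 0 R)).prod volume) := by
    have h1 : Integrable (fun P : ℝ × ℝ => (1 : ℝ) * f P.2)
        ((volume.restrict (Ioc 0 R)).prod volume) :=
      Integrable.mul_prod (integrable_const (1 : ℝ)) hf.integrable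
    refine (h1.bdd_mul (c := C) (f := fun P : ℝ × ℝ => E (P.2 + (x + P.1))) ?_
      (Eventually.of_forall fun P => hC _)).congr (Eventually.of_forall fun P => ?_)
    · exact (show Continuous fun P : ℝ × ℝ => E (P.2 + (x + P.1)) by fun_prop).aestronglyMeasurable
    · simp [Function.uncurry]
  have e : ∫ t in (0 : ℝ)..R, correlation E f (x + t) =
      ∫ z, f z * ∫ t in (0 : ℝ)..R, E (z + x + t) := by
    rw [intervalIntegral.integral_of_le hR0]
    simp only [correlation]
    rw [integral_integral_swap hint]
    congr 1; ext z
    rw [intervalIntegral.integral_of_le hR0, ← integral_const_mul]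
    congr 1; ext t
    rw [add_assoc, mul_comm]
  rw [e, ← Real.norm_eq_abs]
  calc ‖∫ z, f z * ∫ t in (0 : ℝ)..R, E (z + x + t)‖ ≤ ∫ z, |f z| * (ε / (A + 1) * R) := by
        refine norm_integral_le_of_norm_le (hf.integrable.abs.mul_const _)
          (Eventually.of_forall fun z => ?_)
        rw [norm_mul]
        exact mul_le_mul_of_nonneg_left (hR _) (abs_nonneg _)
    _ = A * (ε / (A + 1) * R) := integral_mul_const _ _
    _ ≤ ε * R := by
        rw [div_mul_eq_mul_div, mul_div_assoc', div_le_iff₀ (by positivity)]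
        have : 0 ≤ ε * R := by positivity
        nlinarith

/-- After Fubini, a translation by `d * t` moves the difference from `f` to the correlation and
reverses the direction. -/
lemma integral_mul_marchaud {σ d : ℝ} (hσ0 : 0 < σ) (hσ1 : σ < 1) (hd : |d| = 1)
    (hEc : Continuous E) {C : ℝ} (hC : ∀ x, |E x| ≤ C) (hf : IsTestFunction f) (x : ℝ) :
    ∫ z, E (z + x) * marchaud d σ f z = marchaud (-d) σ (correlation E f) x := by
  have hE : MemLp E ⊤ volume := memLp_top_of_bound hEc.aestronglyMeasurable C
    (Eventually.of_forall hC)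
  have hf1 := memLp_one_iff_integrable.2 hf.integrable
  have hint := (integrable_marchaud_integrand hσ0 hσ1 hd hf).bdd_mul (c := C)
    (f := fun P : ℝ × ℝ => E (P.1 + x))
    (show Continuous fun P : ℝ × ℝ => E (P.1 + x) by fun_prop).aestronglyMeasurable
    (Eventually.of_forall fun P => hC _)
  have hswap := integral_integral_swap (f := fun z t => E (z + x) *
    ((f z - f (z + d * t)) * t ^ (-1 - σ))) hint
  simp only [integral_const_mul] at hswap
  rw [marchaud]
  refine hswap.trans ?_
  congr 1; ext t
  have e : ∀ z, E (z + x) * ((f z - f (z + d * t)) * t ^ (-1 - σ)) =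
      (E (z + x) * f z - E (z + x) * f (z + d * t)) * t ^ (-1 - σ) := fun z => by ring
  simp only [e]
  rw [integral_mul_const, integral_sub (integrable_shift_mul inferInstance hE hf1 x)
    (integrable_shift_mul inferInstance hE (memLp_comp_add_right hf1 (d * t)) x)]
  congr 2
  rw [correlation, ← integral_add_right_eq_self (fun z => E (z + (x + -d * t)) * f z) (d * t)]
  congr 1; ext z; congr 2; ring

/-- Removes one derivative at a time: the correlation with the lower derivative has zero derivative,
hence is constant, and a constant with null averages is zero. -/
lemma correlation_eq_zero_of_iteratedDeriv (hEc : Continuous E) {C : ℝ} (hC : ∀ x, |E x| ≤ C)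
    (hE : HasNullAverages E) (n : ℕ)
    (h : ∀ φ, IsTestFunction φ → ∀ x, correlation E (iteratedDeriv n φ) x = 0) :
    ∀ φ, IsTestFunction φ → ∀ x, correlation E φ x = 0 := by
  have hE' : MemLp E ⊤ volume := memLp_top_of_bound hEc.aestronglyMeasurable C
    (Eventually.of_forall hC)
  induction n with
  | zero => simpa using h
  | succ n ih =>
    refine ih fun φ hφ x => ?_
    have hd : ∀ y, HasDerivAt (correlation E (iteratedDeriv n φ)) 0 y := fun y => by
      have h1 := hasDerivAt_correlation hE' (hφ.iteratedDeriv n) y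
      rwa [← iteratedDeriv_succ, h φ hφ, neg_zero] at h1
    have hconst : ∀ y, correlation E (iteratedDeriv n φ) y =
        correlation E (iteratedDeriv n φ) x := fun y =>
      is_const_of_deriv_eq_zero (fun y => (hd y).differentiableAt) (fun y => (hd y).deriv) y x
    have hn := hasNullAverages_correlation_of_bounded hEc hC hE (hφ.iteratedDeriv n)
    rw [funext hconst] at hn
    exact hn.eq_zero_of_const

/-- A Liouville theorem: a bounded continuous function with null averages that is annihilated by
a fractional derivative is orthogonal to all translates of test functions. -/
theorem correlation_eq_zero_of_integral_fracDeriv_eq_zero (s : FracSide) (α : ℝ) (hEc : Continuous E)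
    {C : ℝ} (hC : ∀ x, |E x| ≤ C) (hE : HasNullAverages E)
    (h : ∀ φ, IsTestFunction φ → ∫ z, E z * fracDeriv s α φ z = 0) :
    ∀ φ, IsTestFunction φ → ∀ x, correlation E φ x = 0 := by
  have hE' : MemLp E ⊤ volume := memLp_top_of_bound hEc.aestronglyMeasurable C
    (Eventually.of_forall hC)
  -- Test functions may be translated, so one orthogonality relation yields the vanishing of a whole
  -- function of `x`.
  have h' : ∀ φ, IsTestFunction φ → ∀ x, ∫ z, E (z + x) * fracDeriv s α φ z = 0 := by
    intro φ hφ x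
    have h1 := h _ (hφ.comp_sub_const x)
    rw [← integral_add_right_eq_self _ x] at h1
    simpa only [fracDeriv_comp_sub_const s hφ, add_sub_cancel_right] using h1
  refine correlation_eq_zero_of_iteratedDeriv hEc hC hE ⌊α⌋₊ fun φ hφ => ?_
  by_cases hα : Int.fract α = 0
  · intro x
    have := h' φ hφ x
    rwa [fracDeriv_of_fract_eq_zero s hα] at this
  have hσ0 := fract_pos_of_ne_zero hα
  have hσ1 := Int.fract_lt_one α
  set f := iteratedDeriv ⌊α⌋₊ φ with hfdef
  have hf : IsTestFunction f := hφ.iteratedDeriv _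
  have hm : ∀ x, marchaud (-s.dir) (Int.fract α) (correlation E f) x = 0 := fun x => by
    have h1 := h' φ hφ x
    simp only [fracDeriv_eq_marchaud' s hα hφ, mul_left_comm (E _)] at h1
    rw [integral_const_mul, integral_mul_marchaud hσ0 hσ1 s.abs_dir hEc hC hf] at h1
    refine (mul_eq_zero.1 h1).resolve_left (div_ne_zero hα (Real.Gamma_pos_of_pos ?_).ne')
    linarith
  have hb : ∀ {g}, IsTestFunction g → ∀ x, |correlation E g x| ≤
      (eLpNorm E ⊤ volume).toReal * (eLpNorm g 1 volume).toReal := fun hg x =>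
    abs_correlation_le inferInstance hE' (memLp_one_iff_integrable.2 hg.integrable) x
  -- `C₀` bounds the correlation and `C₁` its derivative, so `2 * C₀ + C₁` controls the increments
  -- as the maximum principle requires.
  set C₀ := (eLpNorm E ⊤ volume).toReal * (eLpNorm f 1 volume).toReal with hC₀
  set C₁ := (eLpNorm E ⊤ volume).toReal * (eLpNorm (deriv f) 1 volume).toReal with hC₁
  have hC₀0 : 0 ≤ C₀ := by positivity
  have hC₁0 : 0 ≤ C₁ := by positivity
  have hd : -s.dir = 1 ∨ -s.dir = -1 := by rcases s.dir_eq with h | h <;> simp [h]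
  refine eq_zero_of_marchaud_eq_zero hσ0 hσ1 hd
    (continuous_correlation inferInstance hE' (memLp_one_iff_integrable.2 hf.integrable))
    (C := 2 * C₀ + C₁) (fun x => (hb hf x).trans (by linarith)) (fun x t ht => ?_)
    (hasNullAverages_correlation_of_bounded hEc hC hE hf) hm
  rw [mul_min_of_nonneg _ _ (by positivity)]
  refine le_min ?_ ?_
  · have := abs_sub (correlation E f x) (correlation E f (x + -s.dir * t))
    have := hb hf x
    have := hb hf (x + -s.dir * t)
    linarith
  · have h1 := Convex.norm_image_sub_le_of_norm_hasDerivWithin_le (C := C₁)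
      (f := correlation E f) (s := univ) (x := x + -s.dir * t) (y := x)
      (fun y _ => (hasDerivAt_correlation hE' hf y).hasDerivWithinAt)
      (fun y _ => by rw [norm_neg]; exact hb hf.deriv y) convex_univ (mem_univ _) (mem_univ _)
    rw [sub_add_cancel_left, norm_neg, norm_mul, norm_neg, Real.norm_eq_abs s.dir, s.abs_dir, one_mul,
      Real.norm_of_nonneg ht.le] at h1
    refine h1.trans ?_
    gcongr
    linarith

end Liouville

/-! ### Dilations and the mean of an integrable weak derivative. -/

section Dilation

lemma eLpNorm_comp_mul_left {q : ℝ≥0∞} (hq : q ≠ ⊤) (f : ℝ → ℝ) {c : ℝ} (hc : 0 < c) :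
    eLpNorm (fun x => f (c * x)) q volume =
      ENNReal.ofReal c⁻¹ ^ q⁻¹.toReal * eLpNorm f q volume := by
  have h := (measurableEmbedding_mulLeft₀ hc.ne').eLpNorm_map_measure (g := f) (p := q)
    (μ := volume)
  rw [Real.map_volume_mul_left hc.ne', eLpNorm_smul_measure_of_ne_top hq,
    abs_of_pos (inv_pos.2 hc), one_div, smul_eq_mul] at h
  exact h.symm

lemma toReal_eLpNorm_rpow_mul_comp_mul_left {q : ℝ≥0∞} (hq : q ≠ ⊤) (K : ℝ → ℝ) (α : ℝ) {c : ℝ}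
    (hc : 0 < c) :
    (eLpNorm (fun x => c ^ α * K (c * x)) q volume).toReal =
      c ^ (α - q⁻¹.toReal) * (eLpNorm K q volume).toReal := by
  have h := eLpNorm_const_smul (c ^ α) (fun x => K (c * x)) q (volume : Measure ℝ)
  have h1 : 0 ≤ c ^ α := Real.rpow_nonneg hc.le _
  have h2 : eLpNorm (fun x => c ^ α * K (c * x)) q volume =
      ‖c ^ α‖ₑ * eLpNorm (fun x => K (c * x)) q volume := h
  rw [h2, eLpNorm_comp_mul_left hq K hc, ENNReal.toReal_mul, ENNReal.toReal_mul, toReal_enorm,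
    Real.norm_of_nonneg h1, ← ENNReal.toReal_rpow, ENNReal.toReal_ofReal (inv_nonneg.2 hc.le),
    Real.rpow_sub hc, Real.inv_rpow hc.le, div_eq_mul_inv, mul_assoc]

lemma memLp_rpow_mul_comp_mul_left {q : ℝ≥0∞} (hq : q ≠ ⊤) {K : ℝ → ℝ} (hK : MemLp K q volume)
    (α : ℝ) {c : ℝ} (hc : 0 < c) : MemLp (fun x => c ^ α * K (c * x)) q volume := by
  refine MemLp.const_mul ⟨?_, ?_⟩ _
  · exact hK.1.comp_quasiMeasurePreserving (Measure.quasiMeasurePreserving_smul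
      (volume : Measure ℝ) hc.ne')
  · rw [eLpNorm_comp_mul_left hq K hc]
    exact ENNReal.mul_lt_top (ENNReal.rpow_lt_top_of_nonneg ENNReal.toReal_nonneg
      ENNReal.ofReal_ne_top) hK.2

variable {α : ℝ} {p q : ℝ≥0∞} {u K : ℝ → ℝ}

lemma abs_integral_mul_dilation_le (hpq : ENNReal.HolderConjugate p q) (hq : q ≠ ⊤)
    (hu : MemLp u p volume) (hK : MemLp K q volume) {c : ℝ} (hc : 0 < c) :
    |∫ x, u x * (c ^ α * K (c * x))| ≤
      (eLpNorm u p volume).toReal * (c ^ (α - q⁻¹.toReal) * (eLpNorm K q volume).toReal) := by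
  rw [← toReal_eLpNorm_rpow_mul_comp_mul_left hq K α hc]
  exact abs_integral_mul_le_eLpNorm hpq hu (memLp_rpow_mul_comp_mul_left hq hK α hc)

lemma tendsto_rpow_nhdsGT_zero {r : ℝ} (hr : 0 < r) :
    Tendsto (fun c : ℝ => c ^ r) (𝓝[>] 0) (𝓝 0) := by
  have h := (Real.continuousAt_rpow_const 0 r (Or.inr hr.le)).tendsto
  rw [Real.zero_rpow hr.ne'] at h
  exact h.mono_left nhdsWithin_le_nhds

/-- Dilations `c ^ α * K (c * ·)` tend weakly to zero as `c → 0` if they are bounded in the dual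
space of a Lebesgue space with finite exponent, or tend to zero there in norm. -/
lemma tendsto_integral_mul_dilation (hα : 0 < α) (hpq : ENNReal.HolderConjugate p q) (hq : q ≠ ⊤)
    (hu : MemLp u p volume) (hK : MemLp K q volume) {C : ℝ} (hC : ∀ x, |K x| ≤ C)
    (hle : q⁻¹.toReal ≤ α) (hne : p = ⊤ → α ≠ 1) :
    Tendsto (fun c : ℝ => ∫ x, u x * (c ^ α * K (c * x))) (𝓝[>] 0) (𝓝 0) := by
  set N := (eLpNorm K q volume).toReal with hN
  have hN0 : 0 ≤ N := ENNReal.toReal_nonneg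
  by_cases hp : p = ⊤
  -- Compactly supported functions are not dense here, but `q = 1` and `α > 1`, so the dual norm
  -- itself decays like `c ^ (α - 1)`.
  · subst hp
    have hq1 : q = 1 := by
      have := @ENNReal.HolderConjugate.inv_add_inv_eq_one ⊤ q hpq
      simpa using this
    have hlt : 0 < α - q⁻¹.toReal := by
      subst hq1
      simp only [inv_one, ENNReal.toReal_one] at hle ⊢
      exact sub_pos.2 (lt_of_le_of_ne hle (hne rfl).symm)
    have hlim : Tendsto (fun c : ℝ => (eLpNorm u ⊤ volume).toReal * (c ^ (α - q⁻¹.toReal) * N))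
        (𝓝[>] 0) (𝓝 0) := by
      simpa using ((tendsto_rpow_nhdsGT_zero hlt).mul_const N).const_mul
        (eLpNorm u ⊤ volume).toReal
    refine squeeze_zero_norm' ?_ hlim
    filter_upwards [self_mem_nhdsWithin] with c hc
    exact abs_integral_mul_dilation_le hpq hq hu hK hc
  -- For `c < 1` the dual norms stay bounded, so `u` may be replaced by a compactly supported `g`,
  -- against which the factor `c ^ α` gives decay.
  · rw [Metric.tendsto_nhds]
    intro ε hε
    obtain ⟨g, hg1, hg2, hg3, hg4⟩ := hu.exists_hasCompactSupport_eLpNorm_sub_le hp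
      (ε := ENNReal.ofReal (ε / 2 / (N + 1))) (by simpa using by positivity)
    have hgi : Integrable g volume := hg3.integrable_of_hasCompactSupport hg1
    have hlim : Tendsto (fun c : ℝ => c ^ α * (C * ∫ x, |g x|)) (𝓝[>] 0) (𝓝 0) := by
      simpa using (tendsto_rpow_nhdsGT_zero hα).mul_const (C * ∫ x, |g x|)
    filter_upwards [self_mem_nhdsWithin, hlim.eventually (gt_mem_nhds (half_pos hε)),
      mem_nhdsWithin_of_mem_nhds (gt_mem_nhds zero_lt_one)] with c hc hcε hc1
    have hc0 : 0 < c := hc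
    rw [Real.dist_eq, sub_zero]
    have hKc := memLp_rpow_mul_comp_mul_left hq hK α hc0
    have e : ∫ x, u x * (c ^ α * K (c * x)) = (∫ x, (u - g) x * (c ^ α * K (c * x))) +
        ∫ x, g x * (c ^ α * K (c * x)) := by
      rw [← integral_add (integrable_mul_of_holderConjugate hpq (hu.sub hg4) hKc)
        (integrable_mul_of_holderConjugate hpq hg4 hKc)]
      congr 1; ext x; simp only [Pi.sub_apply]; ring
    have h1 : |∫ x, (u - g) x * (c ^ α * K (c * x))| ≤ ε / 2 := by
      refine (abs_integral_mul_dilation_le hpq hq (hu.sub hg4) hK hc0).trans ?_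
      have h2 : (eLpNorm (u - g) p volume).toReal ≤ ε / 2 / (N + 1) :=
        ENNReal.toReal_le_of_le_ofReal (by positivity) hg2
      have h3 : c ^ (α - q⁻¹.toReal) ≤ 1 :=
        Real.rpow_le_one hc0.le (le_of_lt hc1) (sub_nonneg.2 hle)
      have h4 : 0 ≤ c ^ (α - q⁻¹.toReal) := Real.rpow_nonneg hc0.le _
      calc _ ≤ ε / 2 / (N + 1) * (1 * N) := by gcongr
        _ ≤ ε / 2 := by
          rw [one_mul, div_mul_eq_mul_div, div_le_iff₀ (by positivity)]
          nlinarith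
    have h2 : |∫ x, g x * (c ^ α * K (c * x))| ≤ c ^ α * (C * ∫ x, |g x|) := by
      rw [← Real.norm_eq_abs, ← integral_const_mul, ← integral_const_mul]
      refine norm_integral_le_of_norm_le ((hgi.abs.const_mul C).const_mul _)
        (Eventually.of_forall fun x => ?_)
      have h4 : 0 ≤ c ^ α := Real.rpow_nonneg hc0.le _
      rw [norm_mul, norm_mul, Real.norm_of_nonneg h4, Real.norm_eq_abs, Real.norm_eq_abs]
      calc |g x| * (c ^ α * |K (c * x)|) ≤ |g x| * (c ^ α * C) := by gcongr; exact hC _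
        _ = _ := by ring
    rw [e]
    linarith [abs_add_le (∫ x, (u - g) x * (c ^ α * K (c * x))) (∫ x, g x * (c ^ α * K (c * x)))]

lemma exists_isTestFunction_apply_zero : ∃ φ : ℝ → ℝ, IsTestFunction φ ∧ φ 0 = 1 := by
  let b : ContDiffBump (0 : ℝ) := ⟨1, 2, one_pos, one_lt_two⟩
  exact ⟨b, ⟨b.contDiff, b.hasCompactSupport⟩, b.one_of_mem_closedBall (by simp [b])⟩

/-- An integrable weak derivative of order `α` of a function in `L^p` has mean zero if
`α ≥ 1 - 1/p`, unless `α = 1` and `p = ∞`. -/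
lemma IsWeakFracDeriv.integral_eq_zero {s : FracSide} {w : ℝ → ℝ} (hα : 0 < α)
    (hpq : ENNReal.HolderConjugate p q) (hq : q ≠ ⊤) (hu : MemLp u p volume)
    (hw : IsWeakFracDeriv s α u w) (hwi : Integrable w volume)
    (hle : q⁻¹.toReal ≤ α) (hne : p = ⊤ → α ≠ 1) : ∫ x, w x = 0 := by
  obtain ⟨φ, hφ, hφ0⟩ := exists_isTestFunction_apply_zero
  obtain ⟨C, hC⟩ := exists_bound_fracDeriv s.opp (α := α) hφ
  obtain ⟨C', -, hC'⟩ := hφ.exists_bound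
  have hlim := (tendsto_integral_mul_dilation hα hpq hq hu
    (memLp_fracDeriv s.opp (α := α) hφ hpq.symm.one_le) hC hle hne).const_mul ((-1) ^ ⌊α⌋₊)
  rw [mul_zero] at hlim
  -- Testing with `φ (c * ·)` as `c → 0`, where `φ 0 = 1`, recovers the mean of `w`. On the other
  -- side homogeneity produces the dilations of `fracDeriv`.
  have hlim2 : Tendsto (fun c : ℝ => ∫ x, w x * φ (c * x)) (𝓝[>] 0) (𝓝 (∫ x, w x * 1)) := by
    refine tendsto_integral_filter_of_dominated_convergence (fun x => |w x| * C') ?_ ?_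
      (hwi.abs.mul_const _) (Eventually.of_forall fun x => ?_)
    · have := hφ.continuous
      exact Eventually.of_forall fun c => hwi.1.mul
        (show Continuous fun x => φ (c * x) by fun_prop).aestronglyMeasurable
    · refine Eventually.of_forall fun c => Eventually.of_forall fun x => ?_
      rw [norm_mul, Real.norm_eq_abs, Real.norm_eq_abs]
      gcongr
      exact hC' _
    · have h1 : Continuous fun c : ℝ => φ (c * x) := hφ.continuous.comp (by fun_prop)
      have h2 := (h1.tendsto 0).mono_left (nhdsWithin_le_nhds (s := Ioi 0))
      rw [zero_mul, hφ0] at h2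
      exact h2.const_mul _
  simp only [mul_one] at hlim2
  refine tendsto_nhds_unique (hlim2.congr' ?_) hlim
  filter_upwards [self_mem_nhdsWithin] with c hc
  have hφ' : IsTestFunction (fun x => φ (c * x)) := by simpa using hφ.comp_affine (ne_of_gt hc) 0
  rw [hw.2 _ hφ'.contDiff hφ'.hasCompactSupport]
  congr 2; ext x
  rw [fracDeriv_comp_mul s.opp hα hφ hc]

end Dilation

/-! ### Pairing the correlations with test functions and their derivatives. -/

section WeakDerivative

variable {s : FracSide} {α : ℝ} {p₁ p₂ q₁ q₂ : ℝ≥0∞} {u v Du Dv φ : ℝ → ℝ}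

lemma IsWeakFracDeriv.integral_mul_comp_sub (hDu : IsWeakFracDeriv s α u Du)
    (hφ : IsTestFunction φ) (x : ℝ) :
    ∫ y, Du y * φ (y - x) = (-1) ^ ⌊α⌋₊ * ∫ y, u y * fracDeriv s.opp α φ (y - x) := by
  have hφ' := hφ.comp_sub_const x
  rw [hDu.2 _ hφ'.contDiff hφ'.hasCompactSupport]
  simp only [fracDeriv_comp_sub_const _ hφ]

/-- The reflected argument turns the direction `s` back into `s.opp`, and its sign cancels the one
in the weak derivative. Thus `Du` and `Dv` throw the same operator on `φ`. -/
lemma IsWeakFracDeriv.integral_mul_comp_const_sub (hDv : IsWeakFracDeriv s.opp α v Dv)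
    (hφ : IsTestFunction φ) (y : ℝ) :
    ∫ x, Dv x * φ (y - x) = ∫ x, v x * fracDeriv s.opp α φ (y - x) := by
  have hφ' : IsTestFunction (fun z => φ (-z)) := by simpa using hφ.comp_const_sub 0
  have h := hDv.integral_mul_comp_sub hφ' y
  simp only [FracSide.opp_opp, fracDeriv_comp_neg s hφ, neg_sub, mul_left_comm (v _)] at h
  rw [h, integral_const_mul, ← mul_assoc, ← mul_pow, neg_one_mul, neg_neg, one_pow, one_mul]

lemma eq_zero_of_forall_integral_testFunction_mul_eq_zero {E : ℝ → ℝ} (hE : Continuous E)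
    (h : ∀ φ, IsTestFunction φ → ∫ z, φ z * E z = 0) (x : ℝ) : E x = 0 := by
  have h1 := ae_eq_zero_of_integral_contDiff_smul_eq_zero (μ := volume) hE.locallyIntegrable
    (fun g hg hg' => h g ⟨hg, hg'⟩)
  exact congrFun ((hE.ae_eq_iff_eq volume continuous_zero).1 h1) x

lemma integral_mul_sub_const_mul {K G H : ℝ → ℝ} (hK : Integrable K volume) (hG : Continuous G)
    (hH : Continuous H) {A B : ℝ} (hA : ∀ x, |G x| ≤ A) (hB : ∀ x, |H x| ≤ B) (c : ℝ) :
    ∫ z, K z * (G z - c * H z) = (∫ z, K z * G z) - c * ∫ z, K z * H z := by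
  have h1 : Integrable (fun z => K z * G z) volume :=
    hK.mul_bdd (c := A) hG.aestronglyMeasurable (Eventually.of_forall hA)
  have h2 : Integrable (fun z => K z * H z) volume :=
    hK.mul_bdd (c := B) hH.aestronglyMeasurable (Eventually.of_forall hB)
  rw [← integral_const_mul, ← integral_sub h1 (h2.const_mul c)]
  congr 1; ext z; ring

lemma neg_one_pow_mul_self (n : ℕ) : (-1 : ℝ) ^ n * (-1) ^ n = 1 := by
  rw [← mul_pow, neg_one_mul, neg_neg, one_pow]

/-- Both derivatives are moved onto `φ`. The two sides become the iterated integrals of `u y * v x *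
fracDeriv s.opp α φ (y - x)`, whose absolute convergence is what `a` and `b` provide. -/
lemma integral_testFunction_mul_correlation (hpq₁ : ENNReal.HolderConjugate p₁ q₁)
    (hpq₂ : ENNReal.HolderConjugate p₂ q₂)
    (hu : MemLp u p₁ volume) (hv : MemLp v p₂ volume)
    (hDu : IsWeakFracDeriv s α u Du) (hDv : IsWeakFracDeriv s.opp α v Dv)
    (hDu' : MemLp Du q₂ volume) (hDv' : MemLp Dv q₁ volume) {a b : ℝ≥0∞} (ha : 1 ≤ a)
    (hb : 1 ≤ b) (hab : 1 ≤ a⁻¹ + b⁻¹) (hua : MemLp u a volume) (hvb : MemLp v b volume)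
    (hφ : IsTestFunction φ) :
    ∫ z, φ z * correlation Du v z = (-1) ^ ⌊α⌋₊ * ∫ z, φ z * correlation u Dv z := by
  have i1 := integrable_trilinear_of_holderConjugate hpq₂.symm hDu' hv hφ.integrable
  have i2 := integrable_trilinear_of_holderConjugate hpq₁ hu hDv' hφ.integrable
  have i3 := integrable_trilinear ha hb hab hua hvb (integrable_fracDeriv s.opp (α := α) hφ)
    (memLp_top_fracDeriv s.opp hφ)
  rw [integral_correlation_mul i1, integral_trilinear_swap i1, integral_correlation_mul i2]
  simp only [hDu.integral_mul_comp_sub hφ, hDv.integral_mul_comp_const_sub hφ,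
    mul_left_comm (v _)]
  rw [integral_const_mul, integral_trilinear_swap i3]

/-- The dual manoeuvre: the derivative is taken off `φ` and put on the other factor, so both sides
become integrals of `Du y * Dv x * φ (y - x)`. -/
lemma integral_fracDeriv_mul_correlation (hpq₁ : ENNReal.HolderConjugate p₁ q₁)
    (hpq₂ : ENNReal.HolderConjugate p₂ q₂)
    (hu : MemLp u p₁ volume) (hv : MemLp v p₂ volume)
    (hDu : IsWeakFracDeriv s α u Du) (hDv : IsWeakFracDeriv s.opp α v Dv)
    (hDu' : MemLp Du q₂ volume) (hDv' : MemLp Dv q₁ volume) (hq : 1 ≤ q₂⁻¹ + q₁⁻¹)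
    (hφ : IsTestFunction φ) :
    ∫ z, fracDeriv s.opp α φ z * correlation Du v z =
      (-1) ^ ⌊α⌋₊ * ∫ z, fracDeriv s.opp α φ z * correlation u Dv z := by
  have hK := integrable_fracDeriv s.opp (α := α) hφ
  have i1 := integrable_trilinear_of_holderConjugate hpq₂.symm hDu' hv hK
  have i2 := integrable_trilinear_of_holderConjugate hpq₁ hu hDv' hK
  have i3 := integrable_trilinear hpq₂.symm.one_le hpq₁.symm.one_le hq hDu' hDv' hφ.integrable
    (hφ.memLp ⊤)
  have e : ∀ x, ∫ y, u y * fracDeriv s.opp α φ (y - x) = (-1) ^ ⌊α⌋₊ * ∫ y, Du y * φ (y - x) :=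
    fun x => by rw [hDu.integral_mul_comp_sub hφ, ← mul_assoc, neg_one_pow_mul_self, one_mul]
  rw [integral_correlation_mul i1, integral_correlation_mul i2, integral_trilinear_swap i2]
  simp only [e, ← hDv.integral_mul_comp_const_sub hφ, mul_left_comm (Dv _)]
  rw [integral_const_mul, ← mul_assoc, neg_one_pow_mul_self, one_mul, integral_trilinear_swap i3]

/-- When `p₂ = ∞`, `Du` is integrable and must have mean zero. Cancelling `1/p₁` in the endpoint
condition leaves `1/q₁ ≤ α`, the threshold of the dilation argument. -/
lemma hasNullAverages_correlation_weakDeriv (hα : 0 < α)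
    (hpq₁ : ENNReal.HolderConjugate p₁ q₁) (hpq₂ : ENNReal.HolderConjugate p₂ q₂)
    (hq₁ : q₁ ≠ ⊤) (hq₂ : q₂ ≠ ⊤) (hu : MemLp u p₁ volume) (hv : MemLp v p₂ volume)
    (hDu : IsWeakFracDeriv s α u Du) (hDu' : MemLp Du q₂ volume)
    (hend : p₂ ≠ ⊤ ∨ (1 ≤ ENNReal.ofReal α + p₁⁻¹ + p₂⁻¹ ∧ ¬(α = 1 ∧ p₁ = ⊤ ∧ p₂ = ⊤))) :
    HasNullAverages (correlation Du v) := by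
  by_cases hp : p₂ = ⊤
  · obtain ⟨h1, h2⟩ := hend.resolve_left (not_not.2 hp)
    subst hp
    have hq2 : q₂ = 1 := by
      simpa using @ENNReal.HolderConjugate.inv_add_inv_eq_one ⊤ q₂ hpq₂
    subst hq2
    have hi := memLp_one_iff_integrable.1 hDu'
    refine hasNullAverages_correlation_of_integral_eq_zero hi
      (hDu.integral_eq_zero hα hpq₁ hq₁ hu hi ?_ fun h3 h4 => h2 ⟨h4, h3, rfl⟩) hv
    have hsum := @ENNReal.HolderConjugate.inv_add_inv_eq_one p₁ q₁ hpq₁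
    rw [ENNReal.inv_top, add_zero, ← hsum, add_comm] at h1
    have hp1 : p₁⁻¹ ≠ ⊤ := fun h => by rw [h] at hsum; simp at hsum
    exact ENNReal.toReal_le_of_le_ofReal hα.le ((ENNReal.add_le_add_iff_right hp1).1 h1)
  · exact hasNullAverages_correlation hpq₂.symm hq₂ hp hDu' hv

lemma ne_top_of_holderConjugate_of_ne_one (hpq : ENNReal.HolderConjugate p₁ q₁) (hp : p₁ ≠ 1) :
    q₁ ≠ ⊤ := by
  rintro rfl
  have h := @ENNReal.HolderConjugate.inv_add_inv_eq_one p₁ ⊤ hpq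
  exact hp (by simpa using h)

lemma one_le_inv_add_inv_of_holderConjugate (hpq₁ : ENNReal.HolderConjugate p₁ q₁)
    (hpq₂ : ENNReal.HolderConjugate p₂ q₂) (h : p₁⁻¹ + p₂⁻¹ < 1) : 1 ≤ q₂⁻¹ + q₁⁻¹ := by
  by_contra! hlt
  have h1 := @ENNReal.HolderConjugate.inv_add_inv_eq_one p₁ q₁ hpq₁
  have h2 := @ENNReal.HolderConjugate.inv_add_inv_eq_one p₂ q₂ hpq₂
  have h3 := ENNReal.add_lt_add h hlt
  have h4 : p₁⁻¹ + p₂⁻¹ + (q₂⁻¹ + q₁⁻¹) = (p₁⁻¹ + q₁⁻¹) + (p₂⁻¹ + q₂⁻¹) := by ring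
  rw [h4, h1, h2] at h3
  exact lt_irrefl _ h3

end WeakDerivative

theorem mainTheorem8 (s : FracSide) (α : ℝ) (hα : 0 < α)
    (p₁ p₂ q₁ q₂ : ℝ≥0∞)
    (hpq₁ : ENNReal.HolderConjugate p₁ q₁) (hpq₂ : ENNReal.HolderConjugate p₂ q₂)
    (u v Du Dv : ℝ → ℝ)
    (hu : MemLp u p₁ volume) (hv : MemLp v p₂ volume)
    (hDu : IsWeakFracDeriv s α u Du) (hDv : IsWeakFracDeriv s.opp α v Dv)
    (hDu' : MemLp Du q₂ volume) (hDv' : MemLp Dv q₁ volume)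
    (hend : (p₁ ≠ ⊤ ∧ p₂ ≠ ⊤) ∨ MemLp u 1 volume ∨ MemLp v 1 volume ∨
      (1 ≤ ENNReal.ofReal α + p₁⁻¹ + p₂⁻¹ ∧ ¬(α = 1 ∧ p₁ = ⊤ ∧ p₂ = ⊤))) :
    Integrable (fun x => Du x * v x) volume ∧ Integrable (fun x => u x * Dv x) volume ∧
      ∫ x, Du x * v x = (-1) ^ ⌊α⌋₊ * ∫ x, u x * Dv x := by
  refine ⟨integrable_mul_of_holderConjugate hpq₂.symm hDu' hv,
    integrable_mul_of_holderConjugate hpq₁ hu hDv', ?_⟩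
  have hGc := continuous_correlation hpq₂.symm hDu' hv
  have hHc := continuous_correlation hpq₁ hu hDv'
  have hGb := abs_correlation_le hpq₂.symm hDu' hv
  have hHb := abs_correlation_le hpq₁ hu hDv'
  set ε : ℝ := (-1) ^ ⌊α⌋₊ with hε
  set E : ℝ → ℝ := fun z => correlation Du v z - ε * correlation u Dv z with hE
  have hEc : Continuous E := hGc.sub (continuous_const.mul hHc)
  suffices h : ∀ φ, IsTestFunction φ → ∫ z, φ z * E z = 0 by
    have h0 := eq_zero_of_forall_integral_testFunction_mul_eq_zero hEc h 0
    simpa [hE, correlation, sub_eq_zero] using h0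
  -- The exponents need not be `p₁` and `p₂`: an extra assumption `u ∈ L^1` or `v ∈ L^1` also lands
  -- here.
  by_cases hA : ∃ a b : ℝ≥0∞, 1 ≤ a ∧ 1 ≤ b ∧ 1 ≤ a⁻¹ + b⁻¹ ∧ MemLp u a volume ∧ MemLp v b volume
  · obtain ⟨a, b, ha, hb, hab, hua, hvb⟩ := hA
    intro φ hφ
    rw [hE, integral_mul_sub_const_mul hφ.integrable hGc hHc hGb hHb, sub_eq_zero]
    exact integral_testFunction_mul_correlation hpq₁ hpq₂ hu hv hDu hDv hDu' hDv' ha hb hab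
      hua hvb hφ
  have hu1 : ¬ MemLp u 1 volume := fun h =>
    hA ⟨1, p₂, le_rfl, hpq₂.one_le, by simp, h, hv⟩
  have hv1 : ¬ MemLp v 1 volume := fun h =>
    hA ⟨p₁, 1, hpq₁.one_le, le_rfl, by simp, hu, h⟩
  have hlt : p₁⁻¹ + p₂⁻¹ < 1 := not_le.1 fun h =>
    hA ⟨p₁, p₂, hpq₁.one_le, hpq₂.one_le, h, hu, hv⟩
  have hq₁ := ne_top_of_holderConjugate_of_ne_one hpq₁ fun h => hu1 (h ▸ hu)
  have hq₂ := ne_top_of_holderConjugate_of_ne_one hpq₂ fun h => hv1 (h ▸ hv)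
  have hend' : (p₁ ≠ ⊤ ∧ p₂ ≠ ⊤) ∨
      (1 ≤ ENNReal.ofReal α + p₁⁻¹ + p₂⁻¹ ∧ ¬(α = 1 ∧ p₁ = ⊤ ∧ p₂ = ⊤)) := by tauto
  have hGn : HasNullAverages (correlation Du v) :=
    hasNullAverages_correlation_weakDeriv hα hpq₁ hpq₂ hq₁ hq₂ hu hv hDu hDu'
      (hend'.imp And.right id)
  have hHn : HasNullAverages (correlation u Dv) := by
    have := hasNullAverages_correlation_weakDeriv hα hpq₂ hpq₁ hq₂ hq₁ hv hu hDv hDv'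
      (hend'.imp And.left fun h => ⟨by rw [add_right_comm]; exact h.1, fun h' =>
        h.2 ⟨h'.1, h'.2.2, h'.2.1⟩⟩)
    simpa only [← correlation_swap] using this.comp_neg
  -- The pairing `∫ φ E` is the correlation of `E` with `φ` at shift zero.
  intro φ hφ
  have h := correlation_eq_zero_of_integral_fracDeriv_eq_zero s.opp α hEc
    (fun x => (abs_sub _ _).trans (add_le_add (hGb x)
      ((abs_mul ε _).le.trans (mul_le_mul_of_nonneg_left (hHb x) (abs_nonneg ε)))))
    (hGn.sub_const_mul hHn hGc hHc ε) (fun ψ hψ => by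
      simp only [mul_comm (E _)]
      rw [hE, integral_mul_sub_const_mul (integrable_fracDeriv s.opp hψ) hGc hHc hGb hHb,
        sub_eq_zero]
      exact integral_fracDeriv_mul_correlation hpq₁ hpq₂ hu hv hDu hDv hDu' hDv'
        (one_le_inv_add_inv_of_holderConjugate hpq₁ hpq₂ hlt) hψ) φ hφ 0
  simpa [correlation, mul_comm] using h
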